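/- Let $T>0$ and $\Omega=[0,1]\times[0,T]$. Call a function $f$ on $\Omega$ *completely continuous with square integrable densities* if $f(x,t)=f(0,0)+\int_0^x a(y)\,dy+\int_0^t b(s)\,ds+\int_0^x\!\int_0^t c(y,s)\,ds\,dy$ on $\Omega$ with $a\in L^2[0,1]$, $b\in L^2[0,T]$, $c\in L^2(\Omega)$; then $a=\partial_x f(\cdot,0)$, $b=\partial_t f(0,\cdot)$ and $c=\partial_x\partial_t f$ almost everywhere. Let $\widehat W(\Omega)$ be the Hilbert space of all such functions with $$\langle f,g\rangle_{\widehat W}=\int_0^T \partial_t f(0,t)\,\partial_t g(0,t)\,dt+f(0,0)g(0,0)+\int_0^1\partial_xf(x,0)\,\partial_xg(x,0)\,dx+\int_0^1\!\int_0^T\partial_x\partial_tf\;\partial_x\partial_tg\,dt\,dx .$$ Its reproducing kernel is $G_{(y,s)}(x,t)=(1+\min(x,y))(1+\min(t,s))$. Let $W(\Omega)$ be the Hilbert space of all functions $u$ on $\Omega$ whose partial derivatives $\partial_x^i\partial_t^j u$, $i,j\le 2$, exist, such that $\partial_x^2\partial_t^2u$ is completely continuous with square integrable densities (so that $\partial_x^3\partial_t^3u\in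 L^2(\Omega)$), and such that $u(x,0)=\partial_tu(x,0)=u(0,t)=u(1,t)=0$ for $0\le x\le 1$, $0\le t\le T$, with the inner product $$\langle u,g\rangle_W=\sum_{i=0}^2\int_0^T\partial_t^3\partial_x^iu(0,t)\,\partial_t^3\partial_x^ig(0,t)\,dt+\sum_{j=0}^2\big\langle\partial_t^ju(\cdot,0),\partial_t^jg(\cdot,0)\big\rangle_{W_2^3}+\int_0^1\!\int_0^T\partial_x^3\partial_t^3u\;\partial_x^3\partial_t^3g\,dt\,dx,$$ where $\langle h,k\rangle_{W_2^3}=h(0)k(0)+h'(0)k'(0)+h'(1)k'(1)+\int_0^1h'''k'''\,dx$. Let $L:W(\Omega)\to\widehat W(\Omega)$ be the bounded linear operator $Lu=\partial_t^2u-\partial_x^2u$ and $L^*$ its adjoint. Let $(x_i,t_i)_{i\ge1}$ be a sequence of points of $\Omega$ that is dense in $\Omega$, put $\Psi_i=L^*G_{(x_i,t_i)}\in W(\Omega)$, and let $(\widehat\Psi_i)_{i\ge1}$ be obtained from $(\Psi_i)_{i\ge1}$ by Gram–Schmidt orthonormalisation in $W(\Omega)$, where $\widehat\Psi_i=0$ if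 $\Psi_i$ is a linear combination of $\Psi_1,\dots,\Psi_{i-1}$. Then there are real numbers $\beta_{ik}$, $1\le k\le i$, with $\widehat\Psi_i=\sum_{k=1}^i\beta_{ik}\Psi_k$ for all $i$, and for every such choice of the $\beta_{ik}$ the following holds. Let $M:[0,1]\times[0,T]\times\mathbb R\to\mathbb R$ be a function and let $u\in W(\Omega)$ be a solution of the problem $$Lu(x,t)=M(x,t,u(x,t)),\quad (x,t)\in\Omega,\qquad u(x,0)=\partial_tu(x,0)=u(0,t)=u(1,t)=0 .$$ Then $$u(x,t)=\sum_{i=1}^\infty\Big(\sum_{k=1}^i\beta_{ik}\,M\big(x_k,t_k,u(x_k,t_k)\big)\Big)\widehat\Psi_i(x,t),$$ where the series converges unconditionally in the norm of $W(\Omega)$ and at every point of $\Omega$; in particular the truncations $u_n=\sum_{i=1}^n\sum_{k=1}^i\beta_{ik}M(x_k,t_k,u(x_k,t_k))\widehat\Psi_i$ satisfy $\|u_n-u\|_W\to0$ as $n\to\infty$. -/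

import Mathlib

open MeasureTheory Set Filter Topology

noncomputable section

namespace SGK

/-!
The notions in the statement: the rectangle `Omega`, the space `WHat T` with the inner product
`innerHat`, the space `W T` (membership `MemW`) with the inner product `innerW`, the bounded operator
`L : W T →L[ℝ] WHat T`, the reproducing kernel `kernel` of `WHat T`, `Psi` (the adjoint of `L` applied
to kernels), `PsiHat` (Gram-Schmidt), `IsSolution`, `IsCoeff`, `coeff`.

Everything marked as auxiliary, and every theorem, only serves to prove that these are well defined:
that `innerHat` and `innerW` are inner products, that both spaces are complete, that `L` maps into
`WHat T` and is bounded (so that its adjoint exists), and that the kernel belongs to `WHat T`.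
-/

/-- The closed rectangle `[0,1] × [0,T]`. -/
def Omega (T : ℝ) : Set (ℝ × ℝ) := Icc 0 1 ×ˢ Icc 0 T

/-- Membership in `W_2^1[0,S]`: absolutely continuous on `[0,S]` with derivative in `L²[0,S]`
(`deriv f` exists almost everywhere). Only the values of `f` on `[0,S]` matter. -/
def MemW21 (S : ℝ) (f : ℝ → ℝ) : Prop :=
  AbsolutelyContinuousOnInterval f 0 S ∧ MemLp (deriv f) 2 (volume.restrict (Icc 0 S))

/-- The inner product of `W_2^1[0,S]`. -/
def innerW21 (S : ℝ) (f g : ℝ → ℝ) : ℝ :=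
  f 0 * g 0 + ∫ x in (0 : ℝ)..S, deriv f x * deriv g x

/-- Auxiliary: `f` is on `[0,S]` a primitive of the `L²` function `g`. -/
def Rep (S : ℝ) (f g : ℝ → ℝ) : Prop :=
  MemLp g 2 (volume.restrict (Icc 0 S)) ∧ ∀ t ∈ Icc 0 S, f t = f 0 + ∫ s in (0 : ℝ)..t, g s

theorem intInt {S : ℝ} {g : ℝ → ℝ} (hg : MemLp g 2 (volume.restrict (Icc 0 S))) {t : ℝ}
    (ht : t ∈ Icc 0 S) : IntervalIntegrable g volume 0 t := by
  have h1 : IntegrableOn g (Icc 0 S) := hg.integrable one_le_two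
  rw [intervalIntegrable_iff_integrableOn_Icc_of_le ht.1]
  exact h1.mono_set (Icc_subset_Icc_right ht.2)

theorem MemW21.rep {S : ℝ} {f : ℝ → ℝ} (hf : MemW21 S f) : Rep S f (deriv f) := by
  refine ⟨hf.2, fun t ht => ?_⟩
  have h := (hf.1.mono (c := 0) (d := t) (by
    rw [uIcc_of_le ht.1, uIcc_of_le (ht.1.trans ht.2)]
    exact Icc_subset_Icc_right ht.2)).integral_deriv_eq_sub
  rw [h]; ring

theorem ac_congr {S : ℝ} {f g : ℝ → ℝ} (hf : AbsolutelyContinuousOnInterval f 0 S)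
    (h : EqOn f g (uIcc 0 S)) : AbsolutelyContinuousOnInterval g 0 S := by
  rw [absolutelyContinuousOnInterval_iff] at hf ⊢
  intro ε hε
  obtain ⟨δ, hδ, H⟩ := hf ε hε
  refine ⟨δ, hδ, fun E hE hl => ?_⟩
  have := H E hE hl
  convert this using 1
  refine Finset.sum_congr rfl fun i hi => ?_
  have hm := hE.1 i hi
  rw [h hm.1, h hm.2]

theorem Rep.memW21 {S : ℝ} (hS : 0 ≤ S) {f g : ℝ → ℝ} (h : Rep S f g) :
    MemW21 S f ∧ deriv f =ᵐ[volume.restrict (Icc 0 S)] g := by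
  have hi := intInt h.1 (right_mem_Icc.2 hS)
  have hae : deriv f =ᵐ[volume.restrict (Icc 0 S)] g := by
    have h0 := hi.ae_hasDerivAt_integral
    rw [uIcc_of_le hS] at h0
    rw [← restrict_Ioo_eq_restrict_Icc]
    rw [Filter.EventuallyEq, ae_restrict_iff' measurableSet_Ioo]
    filter_upwards [h0] with x hx hxm
    have h1 := (hx (Ioo_subset_Icc_self hxm) 0 (left_mem_Icc.2 hS)).const_add (f 0)
    refine (h1.congr_of_eventuallyEq ?_).deriv
    filter_upwards [Ioo_mem_nhds hxm.1 hxm.2] with y hy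
    exact h.2 y (Ioo_subset_Icc_self hy)
  refine ⟨⟨?_, h.1.ae_eq hae.symm⟩, hae⟩
  have h1 := hi.absolutelyContinuousOnInterval_intervalIntegral (c := 0) left_mem_uIcc
  have h2 : AbsolutelyContinuousOnInterval (fun _ : ℝ => f 0) 0 S :=
    (LipschitzWith.const (f 0)).lipschitzOnWith.absolutelyContinuousOnInterval
  refine ac_congr (h2.add h1) fun t ht => ?_
  rw [uIcc_of_le hS] at ht
  simpa using (h.2 t ht).symm

theorem Rep.add {S : ℝ} {f g f' g' : ℝ → ℝ} (h : Rep S f g) (h' : Rep S f' g') :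
    Rep S (fun x => f x + f' x) (fun x => g x + g' x) := by
  refine ⟨h.1.add h'.1, fun t ht => ?_⟩
  beta_reduce
  rw [intervalIntegral.integral_add (intInt h.1 ht) (intInt h'.1 ht), h.2 t ht, h'.2 t ht]
  ring

theorem Rep.smul {S : ℝ} {f g : ℝ → ℝ} (c : ℝ) (h : Rep S f g) :
    Rep S (fun x => c * f x) (fun x => c * g x) := by
  refine ⟨h.1.const_mul c, fun t ht => ?_⟩
  beta_reduce
  rw [intervalIntegral.integral_const_mul, h.2 t ht]
  ring

theorem Rep.congr {S : ℝ} {f g f' : ℝ → ℝ} (h : Rep S f g)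
    (h' : ∀ t ∈ Icc 0 S, f' t = f t) : Rep S f' g := by
  refine ⟨h.1, fun t ht => ?_⟩
  rw [h' t ht, h' 0 ⟨le_rfl, ht.1.trans ht.2⟩, h.2 t ht]

theorem Rep.continuousOn {S : ℝ} {f g : ℝ → ℝ} (hS : 0 ≤ S) (h : Rep S f g) :
    ContinuousOn f (Icc 0 S) := by
  simpa [uIcc_of_le hS] using (h.memW21 hS).1.1.continuousOn

theorem ae_zero_of_int {S : ℝ} (hS : 0 ≤ S) {g : ℝ → ℝ} (hg : IntegrableOn g (Icc 0 S))
    (h : ∀ t ∈ Icc 0 S, ∫ s in (0 : ℝ)..t, g s = 0) : g =ᵐ[volume.restrict (Icc 0 S)] 0 := by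
  have hi : IntervalIntegrable g volume 0 S := by
    rwa [intervalIntegrable_iff_integrableOn_Icc_of_le hS]
  have h0 := hi.ae_hasDerivAt_integral
  rw [uIcc_of_le hS] at h0
  rw [← restrict_Ioo_eq_restrict_Icc]
  rw [Filter.EventuallyEq, ae_restrict_iff' measurableSet_Ioo]
  filter_upwards [h0] with x hx hxm
  have h1 := (hx (Ioo_subset_Icc_self hxm) 0 (left_mem_Icc.2 hS))
  have h2 : HasDerivAt (fun x => ∫ t in (0 : ℝ)..x, g t) 0 x := by
    refine (hasDerivAt_const x (0 : ℝ)).congr_of_eventuallyEq ?_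
    filter_upwards [Ioo_mem_nhds hxm.1 hxm.2] with y hy
    exact h y (Ioo_subset_Icc_self hy)
  exact h1.unique h2

/-- `c ∈ L²(Ω)` is the mixed derivative `∂²f/∂x∂t`, i.e. the density of the rectangle increments of
`f`. It is unique almost everywhere. -/
def IsMixed (T : ℝ) (f : ℝ → ℝ → ℝ) (c : ℝ × ℝ → ℝ) : Prop :=
  MemLp c 2 (volume.restrict (Omega T)) ∧
    ∀ x ∈ Icc (0 : ℝ) 1, ∀ t ∈ Icc 0 T,
      f x t - f x 0 - f 0 t + f 0 0 = ∫ y in (0 : ℝ)..x, ∫ s in (0 : ℝ)..t, c (y, s)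

/-- `f` is completely (absolutely) continuous on `Ω = [0,1] × [0,T]` in the sense of Carathéodory,
`f(x,t) = f(0,0) + ∫₀ˣ a + ∫₀ᵗ b + ∫₀ˣ∫₀ᵗ c`, with densities `a = ∂f/∂x(·,0)`, `b = ∂f/∂t(0,·)`,
`c = ∂²f/∂x∂t` that are square integrable. -/
def MemAC2 (T : ℝ) (f : ℝ → ℝ → ℝ) : Prop :=
  MemW21 1 (fun x => f x 0) ∧ MemW21 T (f 0) ∧ ∃ c, IsMixed T f c

open Classical in
/-- The mixed derivative `∂²f/∂x∂t` as an (almost everywhere defined) function on `Ω`. -/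
def dxt (T : ℝ) (f : ℝ → ℝ → ℝ) : ℝ × ℝ → ℝ :=
  if h : ∃ c, IsMixed T f c then h.choose else 0

/-- Auxiliary: `f` has the densities `a`, `b`, `c`. -/
structure Rep2 (T : ℝ) (f : ℝ → ℝ → ℝ) (a b : ℝ → ℝ) (c : ℝ × ℝ → ℝ) : Prop where
  ra : Rep 1 (fun x => f x 0) a
  rb : Rep T (f 0) b
  rc : IsMixed T f c

theorem MemAC2.rep {T : ℝ} {f : ℝ → ℝ → ℝ} (h : MemAC2 T f) :
    Rep2 T f (deriv fun x => f x 0) (deriv (f 0)) (dxt T f) := by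
  refine ⟨h.1.rep, h.2.1.rep, ?_⟩
  rw [dxt, dif_pos h.2.2]
  exact h.2.2.choose_spec

theorem restrict_Omega (T : ℝ) : (volume : Measure (ℝ × ℝ)).restrict (Omega T) =
    (volume.restrict (Icc (0 : ℝ) 1)).prod (volume.restrict (Icc 0 T)) := by
  rw [Omega, Measure.prod_restrict]; rfl

instance (T : ℝ) : IsFiniteMeasure ((volume : Measure (ℝ × ℝ)).restrict (Omega T)) := by
  rw [restrict_Omega]; infer_instance

theorem dbl {T : ℝ} {c : ℝ × ℝ → ℝ} (hc : IntegrableOn c (Omega T)) {x t : ℝ}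
    (hx : x ∈ Icc (0 : ℝ) 1) (ht : t ∈ Icc 0 T) :
    ∫ y in (0 : ℝ)..x, ∫ s in (0 : ℝ)..t, c (y, s) = ∫ z in Ioc 0 x ×ˢ Ioc 0 t, c z := by
  have hsub : Ioc 0 x ×ˢ Ioc 0 t ⊆ Omega T :=
    prod_mono (Ioc_subset_Icc_self.trans (Icc_subset_Icc_right hx.2))
      (Ioc_subset_Icc_self.trans (Icc_subset_Icc_right ht.2))
  have := setIntegral_prod (μ := (volume : Measure ℝ)) (ν := (volume : Measure ℝ)) c (hc.mono_set hsub)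
  rw [Measure.volume_eq_prod, this, intervalIntegral.integral_of_le hx.1]
  refine integral_congr_ae (Eventually.of_forall fun y => ?_)
  exact intervalIntegral.integral_of_le ht.1

theorem dbl_full {T : ℝ} (hT : 0 ≤ T) {c : ℝ × ℝ → ℝ} (hc : IntegrableOn c (Omega T)) :
    ∫ y in (0 : ℝ)..1, ∫ s in (0 : ℝ)..T, c (y, s) = ∫ z in Omega T, c z := by
  rw [restrict_Omega, integral_prod _ (by rw [← restrict_Omega]; exact hc),
    intervalIntegral.integral_of_le zero_le_one, ← integral_Icc_eq_integral_Ioc]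
  refine integral_congr_ae (Eventually.of_forall fun y => ?_)
  beta_reduce
  rw [intervalIntegral.integral_of_le hT, ← integral_Icc_eq_integral_Ioc]

theorem intOmega {T : ℝ} {c : ℝ × ℝ → ℝ} (hc : MemLp c 2 (volume.restrict (Omega T))) :
    IntegrableOn c (Omega T) := hc.integrable one_le_two

theorem subOmega {T x t : ℝ} (hx : x ∈ Icc (0 : ℝ) 1) (ht : t ∈ Icc 0 T) :
    Ioc 0 x ×ˢ Ioc 0 t ⊆ Omega T :=
  prod_mono (Ioc_subset_Icc_self.trans (Icc_subset_Icc_right hx.2))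
      (Ioc_subset_Icc_self.trans (Icc_subset_Icc_right ht.2))

theorem IsMixed.add {T : ℝ} {f g : ℝ → ℝ → ℝ} {c d : ℝ × ℝ → ℝ} (hf : IsMixed T f c)
    (hg : IsMixed T g d) : IsMixed T (fun x t => f x t + g x t) (fun z => c z + d z) := by
  refine ⟨hf.1.add hg.1, fun x hx t ht => ?_⟩
  have h1 := hf.2 x hx t ht
  have h2 := hg.2 x hx t ht
  rw [dbl (intOmega hf.1) hx ht] at h1
  rw [dbl (intOmega hg.1) hx ht] at h2
  rw [dbl (c := fun z => c z + d z) (intOmega (hf.1.add hg.1)) hx ht,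
    integral_add ((intOmega hf.1).mono_set (subOmega hx ht))
      ((intOmega hg.1).mono_set (subOmega hx ht)), ← h1, ← h2]
  ring

theorem IsMixed.smul {T : ℝ} {f : ℝ → ℝ → ℝ} {c : ℝ × ℝ → ℝ} (r : ℝ) (hf : IsMixed T f c) :
    IsMixed T (fun x t => r * f x t) (fun z => r * c z) := by
  refine ⟨hf.1.const_mul r, fun x hx t ht => ?_⟩
  have h1 := hf.2 x hx t ht
  simp only [intervalIntegral.integral_const_mul]
  rw [← h1]; ring

theorem IsMixed.congr {T : ℝ} {f g : ℝ → ℝ → ℝ} {c : ℝ × ℝ → ℝ} (hf : IsMixed T f c)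
    (h : ∀ x ∈ Icc (0 : ℝ) 1, ∀ t ∈ Icc 0 T, g x t = f x t) : IsMixed T g c := by
  refine ⟨hf.1, fun x hx t ht => ?_⟩
  have h0 : (0 : ℝ) ∈ Icc (0 : ℝ) 1 := by simp
  have h0' : (0 : ℝ) ∈ Icc (0 : ℝ) T := ⟨le_rfl, ht.1.trans ht.2⟩
  rw [h x hx t ht, h x hx 0 h0', h 0 h0 t ht, h 0 h0 0 h0', hf.2 x hx t ht]

theorem ae_zero_of_dbl {T : ℝ} (hT : 0 ≤ T) {c : ℝ × ℝ → ℝ} (hc : IntegrableOn c (Omega T))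
    (h : ∀ x ∈ Icc (0 : ℝ) 1, ∀ t ∈ Icc 0 T, ∫ y in (0 : ℝ)..x, ∫ s in (0 : ℝ)..t, c (y, s) = 0) :
    c =ᵐ[volume.restrict (Omega T)] 0 := by
  have hc' : Integrable c ((volume.restrict (Icc (0 : ℝ) 1)).prod (volume.restrict (Icc 0 T))) := by
    rw [← restrict_Omega]; exact hc
  obtain ⟨D, hDc, hDd⟩ := TopologicalSpace.exists_countable_dense (Icc 0 T)
  have h1 : ∀ t ∈ D, ∀ᵐ y ∂(volume.restrict (Icc (0 : ℝ) 1)), ∫ s in (0 : ℝ)..t, c (y, s) = 0 := by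
    intro t _
    refine ae_zero_of_int zero_le_one ?_ fun x hx => h x hx t t.2
    have h2 : Integrable c ((volume.restrict (Icc (0 : ℝ) 1)).prod
        (volume.restrict (Ioc 0 (t : ℝ)))) := by
      refine hc'.mono_measure (Measure.prod_mono le_rfl (Measure.restrict_mono ?_ le_rfl))
      exact Ioc_subset_Icc_self.trans (Icc_subset_Icc_right t.2.2)
    refine h2.integral_prod_left.congr (Eventually.of_forall fun y => ?_)
    exact (intervalIntegral.integral_of_le t.2.1).symm
  have h3 := (ae_ball_iff hDc).2 h1
  have h4 : ∀ᵐ y ∂(volume.restrict (Icc (0 : ℝ) 1)), ∀ᵐ s ∂(volume.restrict (Icc (0 : ℝ) T)),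
      c (y, s) = 0 := by
    filter_upwards [h3, hc'.prod_right_ae] with y hy hyi
    refine ae_zero_of_int hT hyi fun t ht => ?_
    have hcont : ContinuousOn (fun t => ∫ s in (0 : ℝ)..t, c (y, s)) (Icc 0 T) := by
      have := intervalIntegral.continuousOn_primitive_interval (f := fun s => c (y, s))
        (μ := volume) (a := 0) (b := T) (by rw [uIcc_of_le hT]; exact hyi)
      rwa [uIcc_of_le hT] at this
    have := Continuous.ext_on hDd (continuousOn_iff_continuous_domRestrict.1 hcont)
      (continuous_const (y := (0 : ℝ))) (fun t ht => hy t ht)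
    exact congrFun this ⟨t, ht⟩
  have h5 : ∫ z in Omega T, ‖c z‖ = 0 := by
    rw [restrict_Omega, integral_prod _ hc'.norm]
    rw [integral_congr_ae (g := fun _ => (0 : ℝ)), integral_zero]
    filter_upwards [h4] with y hy
    rw [integral_congr_ae (g := fun _ => (0 : ℝ)), integral_zero]
    filter_upwards [hy] with s hs
    simp [hs]
  rw [integral_eq_zero_iff_of_nonneg (fun _ => norm_nonneg _) hc.norm] at h5
  filter_upwards [h5] with z hz
  simpa using hz

theorem IsMixed.unique {T : ℝ} (hT : 0 ≤ T) {f : ℝ → ℝ → ℝ} {c d : ℝ × ℝ → ℝ} (hc : IsMixed T f c)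
    (hd : IsMixed T f d) : c =ᵐ[volume.restrict (Omega T)] d := by
  have h1 := (hc.add (hd.smul (-1)))
  have := ae_zero_of_dbl hT (intOmega h1.1) (fun x hx t ht => by rw [← h1.2 x hx t ht]; ring)
  filter_upwards [this] with z hz
  simp only [Pi.zero_apply] at hz
  linarith

theorem Rep2.memAC2 {T : ℝ} (hT : 0 ≤ T) {f : ℝ → ℝ → ℝ} {a b : ℝ → ℝ} {c : ℝ × ℝ → ℝ}
    (h : Rep2 T f a b c) : MemAC2 T f :=
  ⟨(h.ra.memW21 zero_le_one).1, (h.rb.memW21 hT).1, c, h.rc⟩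

theorem Rep2.dxt {T : ℝ} (hT : 0 ≤ T) {f : ℝ → ℝ → ℝ} {a b : ℝ → ℝ} {c : ℝ × ℝ → ℝ}
    (h : Rep2 T f a b c) : dxt T f =ᵐ[volume.restrict (Omega T)] c :=
  (h.memAC2 hT).rep.rc.unique hT h.rc

theorem Rep2.add {T : ℝ} {f f' : ℝ → ℝ → ℝ} {a b a' b' : ℝ → ℝ} {c c' : ℝ × ℝ → ℝ}
    (h : Rep2 T f a b c) (h' : Rep2 T f' a' b' c') :
    Rep2 T (fun x t => f x t + f' x t) (fun x => a x + a' x) (fun x => b x + b' x)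
      (fun x => c x + c' x) :=
  ⟨h.ra.add h'.ra, h.rb.add h'.rb, h.rc.add h'.rc⟩

theorem Rep2.smul {T : ℝ} {f : ℝ → ℝ → ℝ} {a b : ℝ → ℝ} {c : ℝ × ℝ → ℝ} (r : ℝ)
    (h : Rep2 T f a b c) :
    Rep2 T (fun x t => r * f x t) (fun x => r * a x) (fun x => r * b x) (fun x => r * c x) :=
  ⟨h.ra.smul r, h.rb.smul r, h.rc.smul r⟩

theorem Rep2.congr {T : ℝ} (hT : 0 ≤ T) {f g : ℝ → ℝ → ℝ} {a b : ℝ → ℝ} {c : ℝ × ℝ → ℝ}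
    (h : Rep2 T f a b c)
    (e : ∀ x ∈ Icc (0 : ℝ) 1, ∀ t ∈ Icc 0 T, g x t = f x t) : Rep2 T g a b c :=
  ⟨h.ra.congr fun x hx => e x hx 0 ⟨le_rfl, hT⟩, h.rb.congr fun t ht => e 0 (by simp) t ht,
    h.rc.congr e⟩

theorem MemAC2.congr {T : ℝ} (hT : 0 ≤ T) {f g : ℝ → ℝ → ℝ} (h : MemAC2 T f)
    (e : ∀ x ∈ Icc (0 : ℝ) 1, ∀ t ∈ Icc 0 T, g x t = f x t) : MemAC2 T g :=
  (h.rep.congr hT e).memAC2 hT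

theorem MemAC2.add {T : ℝ} (hT : 0 ≤ T) {f g : ℝ → ℝ → ℝ} (h : MemAC2 T f) (h' : MemAC2 T g) :
    MemAC2 T (fun x t => f x t + g x t) := (h.rep.add h'.rep).memAC2 hT

theorem MemAC2.smul {T : ℝ} (hT : 0 ≤ T) {f : ℝ → ℝ → ℝ} (r : ℝ) (h : MemAC2 T f) :
    MemAC2 T (fun x t => r * f x t) := (h.rep.smul r).memAC2 hT

theorem continuousOn_dbl {T : ℝ} {c : ℝ × ℝ → ℝ} (hc : IntegrableOn c (Omega T)) :
    ContinuousOn (fun p : ℝ × ℝ => ∫ y in (0 : ℝ)..p.1, ∫ s in (0 : ℝ)..p.2, c (y, s))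
      (Omega T) := by
  have key : Continuous (fun p : ℝ × ℝ =>
      ∫ z in Omega T, (Ioc 0 p.1 ×ˢ Ioc 0 p.2).indicator c z) := by
    rw [continuous_iff_continuousAt]
    intro p
    refine tendsto_integral_filter_of_dominated_convergence (fun z => ‖c z‖) ?_ ?_ hc.norm ?_
    · exact Eventually.of_forall fun q => hc.1.indicator (measurableSet_Ioc.prod measurableSet_Ioc)
    · exact Eventually.of_forall fun q => Eventually.of_forall fun z => norm_indicator_le_norm_self _ _
    · have hn : ∀ᵐ z : ℝ × ℝ, z.1 ≠ p.1 ∧ z.2 ≠ p.2 := by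
        have e1 : ∀ᵐ z : ℝ × ℝ, z.1 ≠ p.1 := by
          have := (Measure.quasiMeasurePreserving_fst (μ := (volume : Measure ℝ))
            (ν := (volume : Measure ℝ))).ae (Measure.ae_ne volume p.1)
          simpa [Measure.volume_eq_prod] using this
        have e2 : ∀ᵐ z : ℝ × ℝ, z.2 ≠ p.2 := by
          have := (Measure.quasiMeasurePreserving_snd (μ := (volume : Measure ℝ))
            (ν := (volume : Measure ℝ))).ae (Measure.ae_ne volume p.2)
          simpa [Measure.volume_eq_prod] using this
        exact e1.and e2
      filter_upwards [ae_restrict_of_ae hn] with z hz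
      apply tendsto_nhds_of_eventually_eq
      have l1 : ∀ᶠ q : ℝ × ℝ in 𝓝 p, (z.1 ≤ q.1 ↔ z.1 ≤ p.1) := by
        rcases lt_or_gt_of_ne hz.1 with h | h
        · filter_upwards [continuous_fst.continuousAt.eventually (lt_mem_nhds h)] with q hq
          exact ⟨fun _ => h.le, fun _ => hq.le⟩
        · filter_upwards [continuous_fst.continuousAt.eventually (gt_mem_nhds h)] with q hq
          exact ⟨fun h' => absurd h' (not_le.2 hq), fun h' => absurd h' (not_le.2 h)⟩
      have l2 : ∀ᶠ q : ℝ × ℝ in 𝓝 p, (z.2 ≤ q.2 ↔ z.2 ≤ p.2) := by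
        rcases lt_or_gt_of_ne hz.2 with h | h
        · filter_upwards [continuous_snd.continuousAt.eventually (lt_mem_nhds h)] with q hq
          exact ⟨fun _ => h.le, fun _ => hq.le⟩
        · filter_upwards [continuous_snd.continuousAt.eventually (gt_mem_nhds h)] with q hq
          exact ⟨fun h' => absurd h' (not_le.2 hq), fun h' => absurd h' (not_le.2 h)⟩
      filter_upwards [l1, l2] with q h1 h2
      simp only [indicator, mem_prod, mem_Ioc, h1, h2]
  refine key.continuousOn.congr fun p hp => ?_
  beta_reduce
  rw [dbl hc hp.1 hp.2, setIntegral_indicator (measurableSet_Ioc.prod measurableSet_Ioc),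
    inter_eq_self_of_subset_right (subOmega hp.1 hp.2)]

theorem Rep2.continuousOn {T : ℝ} (hT : 0 ≤ T) {f : ℝ → ℝ → ℝ} {a b : ℝ → ℝ} {c : ℝ × ℝ → ℝ}
    (h : Rep2 T f a b c) : ContinuousOn (fun p : ℝ × ℝ => f p.1 p.2) (Omega T) := by
  have h1 : ContinuousOn (fun p : ℝ × ℝ => f p.1 0) (Omega T) :=
    (h.ra.continuousOn zero_le_one).comp continuous_fst.continuousOn fun p hp => hp.1
  have h2 : ContinuousOn (fun p : ℝ × ℝ => f 0 p.2) (Omega T) :=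
    (h.rb.continuousOn hT).comp continuous_snd.continuousOn fun p hp => hp.2
  refine (((h1.add h2).sub (continuousOn_const (c := f 0 0))).add
    (continuousOn_dbl (intOmega h.rc.1))).congr fun p hp => ?_
  have := h.rc.2 p.1 hp.1 p.2 hp.2
  simp only [Pi.add_apply, Pi.sub_apply]
  rw [← this]; ring

section

/-- The inner product of `Ŵ(Ω)`. -/
def innerHat (T : ℝ) (f g : ℝ → ℝ → ℝ) : ℝ :=
  (∫ t in (0 : ℝ)..T, deriv (f 0) t * deriv (g 0) t)
    + innerW21 1 (fun x => f x 0) (fun x => g x 0)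
    + ∫ x in (0 : ℝ)..1, ∫ t in (0 : ℝ)..T, dxt T f (x, t) * dxt T g (x, t)

theorem pos {T : ℝ} [h : Fact (0 < T)] : 0 < T := h.out

/-- The space `Ŵ(Ω)`. A function on `Ω` is represented by its extension by zero to `ℝ × ℝ`. -/
def WHatSub (T : ℝ) [Fact (0 < T)] : Submodule ℝ (ℝ → ℝ → ℝ) where
  carrier := {f | (∀ x t, (x, t) ∉ Omega T → f x t = 0) ∧ MemAC2 T f}
  add_mem' := fun {f g} hf hg =>
    ⟨fun x t h => by simp [hf.1 x t h, hg.1 x t h], hf.2.add pos.le hg.2⟩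
  zero_mem' := ⟨fun _ _ _ => rfl, by
    have hr : ∀ S : ℝ, Rep S (fun _ => 0) (fun _ => 0) := fun S => ⟨MemLp.zero, by simp⟩
    exact Rep2.memAC2 pos.le (a := fun _ => 0) (b := fun _ => 0) (c := fun _ => 0)
      ⟨hr 1, hr T, MemLp.zero, by simp⟩⟩
  smul_mem' := fun r f hf => ⟨fun x t h => by simp [hf.1 x t h], hf.2.smul pos.le r⟩

/-- The space `Ŵ(Ω)` as a type of its own; it carries the norm topology of `innerHat`. -/
def WHat (T : ℝ) [Fact (0 < T)] : Type := WHatSub T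

variable {T : ℝ} [Fact (0 < T)]

instance : AddCommGroup (WHat T) := inferInstanceAs (AddCommGroup (WHatSub T))
instance : Module ℝ (WHat T) := inferInstanceAs (Module ℝ (WHatSub T))
/-- The underlying function. -/
def WHat.fn (f : WHat T) : ℝ → ℝ → ℝ := f.1
instance : CoeFun (WHat T) (fun _ => ℝ → ℝ → ℝ) := ⟨WHat.fn⟩

/-- The inner product space structure pulled back along an injective linear map. -/
@[reducible]
def coreOf {V E : Type*} [AddCommGroup V] [Module ℝ V] [NormedAddCommGroup E]
    [InnerProductSpace ℝ E] (ip : V → V → ℝ) (F : V →ₗ[ℝ] E) (hF : ∀ v, F v = 0 → v = 0)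
    (h : ∀ u v, ip u v = inner ℝ (F u) (F v)) : InnerProductSpace.Core ℝ V where
  inner := ip
  conj_inner_symm u v := by simp [h, real_inner_comm]
  re_inner_nonneg u := by simp [h]
  add_left u v w := by simp [h, inner_add_left]
  smul_left u v r := by simp [h, inner_smul_left]
  definite u hu := hF u (by rwa [h, inner_self_eq_zero] at hu)

abbrev L2 (S : ℝ) : Type := Lp ℝ 2 (volume.restrict (Icc (0 : ℝ) S))
abbrev L2O (T : ℝ) : Type := Lp ℝ 2 ((volume : Measure (ℝ × ℝ)).restrict (Omega T))
abbrev E0 (T : ℝ) : Type := WithLp 2 (L2 1 × WithLp 2 (L2 T × L2O T))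

theorem WHat.rep (f : WHat T) :
    Rep2 T f (deriv fun x => f x 0) (deriv (f 0)) (dxt T f) := f.2.2.rep

theorem WHat.ext {f g : WHat T} (h : ∀ x ∈ Icc (0 : ℝ) 1, ∀ t ∈ Icc 0 T, f x t = g x t) : f = g := by
  apply Subtype.ext
  funext x t
  by_cases hx : (x, t) ∈ Omega T
  · exact h x hx.1 t hx.2
  · exact (f.2.1 x t hx).trans (g.2.1 x t hx).symm

theorem WHat.toLp_a {f : WHat T} {a b : ℝ → ℝ} {c : ℝ × ℝ → ℝ} (h : Rep2 T f a b c) :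
    f.rep.ra.1.toLp _ = h.ra.1.toLp _ :=
  MemLp.toLp_congr _ _ (h.ra.memW21 zero_le_one).2

theorem WHat.toLp_b {f : WHat T} {a b : ℝ → ℝ} {c : ℝ × ℝ → ℝ} (h : Rep2 T f a b c) :
    f.rep.rb.1.toLp _ = h.rb.1.toLp _ :=
  MemLp.toLp_congr _ _ (h.rb.memW21 pos.le).2

theorem WHat.toLp_c {f : WHat T} {a b : ℝ → ℝ} {c : ℝ × ℝ → ℝ} (h : Rep2 T f a b c) :
    f.rep.rc.1.toLp _ = h.rc.1.toLp _ :=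
  MemLp.toLp_congr _ _ (h.dxt pos.le)

/-- The triple of derivatives occurring in the inner product. -/
def jet0 : WHat T →ₗ[ℝ] E0 T where
  toFun f := WithLp.toLp 2 (f.rep.ra.1.toLp _, WithLp.toLp 2 (f.rep.rb.1.toLp _, f.rep.rc.1.toLp _))
  map_add' f g := by
    have h : Rep2 T (f + g : WHat T) _ _ _ := f.rep.add g.rep
    rw [WHat.toLp_a h, WHat.toLp_b h, WHat.toLp_c h]
    rfl
  map_smul' r f := by
    have h : Rep2 T (r • f : WHat T) _ _ _ := f.rep.smul r
    rw [WHat.toLp_a h, WHat.toLp_b h, WHat.toLp_c h]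
    rfl

theorem inner_toLp {α : Type*} [MeasurableSpace α] {μ : Measure α} {f g : α → ℝ}
    (hf : MemLp f 2 μ) (hg : MemLp g 2 μ) :
    inner ℝ (hf.toLp f) (hg.toLp g) = ∫ x, f x * g x ∂μ := by
  rw [L2.inner_def]
  refine integral_congr_ae ?_
  filter_upwards [hf.coeFn_toLp, hg.coeFn_toLp] with x h1 h2
  rw [h1, h2]; simp [mul_comm]

theorem inner_toLp_int {S : ℝ} (hS : 0 ≤ S) {f g : ℝ → ℝ}
    (hf : MemLp f 2 (volume.restrict (Icc 0 S))) (hg : MemLp g 2 (volume.restrict (Icc 0 S))) :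
    inner ℝ (hf.toLp f) (hg.toLp g) = ∫ x in (0 : ℝ)..S, f x * g x := by
  rw [inner_toLp, intervalIntegral.integral_of_le hS, integral_Icc_eq_integral_Ioc]

theorem inner_toLp_dbl {f g : ℝ × ℝ → ℝ}
    (hf : MemLp f 2 (volume.restrict (Omega T))) (hg : MemLp g 2 (volume.restrict (Omega T))) :
    inner ℝ (hf.toLp f) (hg.toLp g) =
      ∫ x in (0 : ℝ)..1, ∫ t in (0 : ℝ)..T, f (x, t) * g (x, t) := by
  rw [inner_toLp]
  exact (dbl_full (c := fun z => f z * g z) pos.le (hf.integrable_mul hg)).symm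

theorem inner_jet0 (f g : WHat T) : inner ℝ (jet0 f) (jet0 g) =
    (∫ x in (0 : ℝ)..1, deriv (fun x => f x 0) x * deriv (fun x => g x 0) x)
    + ((∫ t in (0 : ℝ)..T, deriv (f 0) t * deriv (g 0) t)
    + ∫ x in (0 : ℝ)..1, ∫ t in (0 : ℝ)..T, dxt T f (x, t) * dxt T g (x, t)) := by
  rw [← inner_toLp_int zero_le_one f.rep.ra.1 g.rep.ra.1,
    ← inner_toLp_int pos.le f.rep.rb.1 g.rep.rb.1, ← inner_toLp_dbl f.rep.rc.1 g.rep.rc.1]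
  simp only [jet0, LinearMap.coe_mk, AddHom.coe_mk, WithLp.prod_inner_apply]

/-- Auxiliary: point evaluation. -/
def WHat.eval (x t : ℝ) : WHat T →ₗ[ℝ] ℝ where
  toFun f := f x t
  map_add' _ _ := rfl
  map_smul' _ _ := rfl

abbrev EHat (T : ℝ) : Type := WithLp 2 (ℝ × E0 T)

/-- Auxiliary: the isometry of `Ŵ(Ω)` with `ℝ × L² × L² × L²`. -/
def jetHat : WHat T →ₗ[ℝ] EHat T :=
  (WithLp.linearEquiv 2 ℝ (ℝ × E0 T)).symm.toLinearMap ∘ₗ (WHat.eval 0 0).prod jet0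

theorem jetHat_apply (f : WHat T) : jetHat f = WithLp.toLp 2 (f 0 0, jet0 f) := rfl

theorem WHat.eq_of_jet {f : WHat T} {a b : ℝ → ℝ} {c : ℝ × ℝ → ℝ} (h : Rep2 T f a b c)
    {x t : ℝ} (hx : x ∈ Icc (0 : ℝ) 1) (ht : t ∈ Icc 0 T) :
    f x t = f 0 0 + (∫ y in (0 : ℝ)..x, a y) + (∫ s in (0 : ℝ)..t, b s)
      + ∫ z in Ioc 0 x ×ˢ Ioc 0 t, c z := by
  have h1 := h.ra.2 x hx
  have h2 := h.rb.2 t ht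
  have h3 := h.rc.2 x hx t ht
  rw [dbl (intOmega h.rc.1) hx ht] at h3
  linarith

theorem jet0_zero {f : WHat T} (h : jet0 f = 0) {x t : ℝ} (hx : x ∈ Icc (0 : ℝ) 1)
    (ht : t ∈ Icc 0 T) : f x t = f 0 0 := by
  have h1 : f.rep.ra.1.toLp _ = 0 := congrArg (fun e : E0 T => e.ofLp.1) h
  have h2 : f.rep.rb.1.toLp _ = 0 := congrArg (fun e : E0 T => e.ofLp.2.ofLp.1) h
  have h3 : f.rep.rc.1.toLp _ = 0 := congrArg (fun e : E0 T => e.ofLp.2.ofLp.2) h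
  rw [← MemLp.toLp_zero MemLp.zero', MemLp.toLp_eq_toLp_iff] at h1 h2 h3
  rw [WHat.eq_of_jet f.rep hx ht, intervalIntegral.integral_of_le hx.1,
    intervalIntegral.integral_of_le ht.1]
  rw [integral_eq_zero_of_ae (ae_restrict_of_ae_restrict_of_subset
      (Ioc_subset_Icc_self.trans (Icc_subset_Icc_right hx.2)) h1),
    integral_eq_zero_of_ae (ae_restrict_of_ae_restrict_of_subset
      (Ioc_subset_Icc_self.trans (Icc_subset_Icc_right ht.2)) h2),
    integral_eq_zero_of_ae (ae_restrict_of_ae_restrict_of_subset (subOmega hx ht) h3)]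
  ring

theorem jetHat_inj (f : WHat T) (h : jetHat f = 0) : f = 0 := by
  have h0 : f 0 0 = 0 := congrArg (fun e : EHat T => e.ofLp.1) h
  have h1 : jet0 f = 0 := congrArg (fun e : EHat T => e.ofLp.2) h
  exact WHat.ext fun x hx t ht => (jet0_zero h1 hx ht).trans h0

theorem innerHat_eq (f g : WHat T) : innerHat T f g = inner ℝ (jetHat f) (jetHat g) := by
  rw [jetHat_apply, jetHat_apply, WithLp.prod_inner_apply]
  simp only [inner_jet0, innerHat, innerW21]
  simp
  ring

@[reducible] def coreHat : InnerProductSpace.Core ℝ (WHat T) :=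
  coreOf (fun f g => innerHat T f g) jetHat jetHat_inj innerHat_eq

instance : NormedAddCommGroup (WHat T) := (coreHat (T := T)).toNormedAddCommGroup
instance : InnerProductSpace ℝ (WHat T) := InnerProductSpace.ofCore (coreHat (T := T)).toCore

theorem WHat.inner_eq (f g : WHat T) : inner ℝ f g = innerHat T f g := rfl

theorem norm_jetHat (f : WHat T) : ‖jetHat f‖ = ‖f‖ := by
  rw [@norm_eq_sqrt_real_inner _ _ _ f, @norm_eq_sqrt_real_inner _ _ _ (jetHat f),
    WHat.inner_eq, innerHat_eq]

open Classical in
/-- The element of `Ŵ(Ω)` given by a function on `Ω`. -/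
def WHat.mk' (f : ℝ → ℝ → ℝ) (hf : MemAC2 T f) : WHat T :=
  ⟨fun x t => if (x, t) ∈ Omega T then f x t else 0, fun x t h => by simp [h],
    hf.congr pos.le fun x hx t ht => if_pos (show (x, t) ∈ Omega T from ⟨hx, ht⟩)⟩

theorem WHat.mk'_apply {f : ℝ → ℝ → ℝ} {hf : MemAC2 T f} {x t : ℝ} (hx : x ∈ Icc (0 : ℝ) 1)
    (ht : t ∈ Icc 0 T) : WHat.mk' f hf x t = f x t :=
  if_pos (show (x, t) ∈ Omega T from ⟨hx, ht⟩)

theorem jetHat_surj (e : EHat T) : ∃ f : WHat T, jetHat f = e := by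
  obtain ⟨r, ⟨a, ⟨b, c⟩⟩⟩ := e
  set F : ℝ → ℝ → ℝ := fun x t => r + (∫ y in (0 : ℝ)..x, a y) + (∫ s in (0 : ℝ)..t, b s)
      + ∫ y in (0 : ℝ)..x, ∫ s in (0 : ℝ)..t, c (y, s) with hF
  have hR : Rep2 T F a b c :=
    ⟨⟨Lp.memLp a, fun x hx => by simp [hF]⟩, ⟨Lp.memLp b, fun t ht => by simp [hF]⟩,
      ⟨Lp.memLp c, fun x hx t ht => by simp [hF]; ring⟩⟩
  refine ⟨WHat.mk' F (hR.memAC2 pos.le), ?_⟩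
  have hR' : Rep2 T (WHat.mk' F (hR.memAC2 pos.le)) a b c :=
    hR.congr pos.le fun x hx t ht => WHat.mk'_apply hx ht
  have h0 : WHat.mk' F (hR.memAC2 pos.le) 0 0 = r := by
    rw [WHat.mk'_apply (by simp) ⟨le_rfl, pos.le⟩]; simp [hF]
  rw [jetHat_apply, h0]
  simp only [jet0, LinearMap.coe_mk, AddHom.coe_mk]
  rw [WHat.toLp_a hR', WHat.toLp_b hR', WHat.toLp_c hR']
  simp

instance : CompleteSpace (WHat T) := by
  let e : WHat T ≃ₗᵢ[ℝ] EHat T :=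
    LinearIsometryEquiv.ofSurjective ⟨jetHat, norm_jetHat⟩ jetHat_surj
  exact (completeSpace_congr (e := e.toEquiv) e.isometry.isUniformEmbedding).2 inferInstance

theorem abs_setIntegral_le {α : Type*} [MeasurableSpace α] {μ : Measure α} [IsFiniteMeasure μ]
    {g : α → ℝ} (hg : MemLp g 2 μ) {s : Set α} (hs : MeasurableSet s) :
    |∫ x in s, g x ∂μ| ≤ (μ.real univ) ^ (1 / 2 : ℝ) * ‖hg.toLp g‖ := by
  have h1 := L2.inner_indicatorConstLp_one (𝕜 := ℝ) hs (measure_ne_top μ s) (hg.toLp g)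
  have h2 : ∫ x in s, g x ∂μ = ∫ x in s, hg.toLp g x ∂μ :=
    integral_congr_ae (ae_restrict_of_ae (hg.coeFn_toLp.symm))
  rw [h2, ← h1]
  refine (abs_real_inner_le_norm _ _).trans (mul_le_mul_of_nonneg_right ?_ (norm_nonneg _))
  rw [norm_indicatorConstLp (by norm_num) (by norm_num)]
  simp only [norm_one, one_mul, ENNReal.toReal_ofNat]
  exact Real.rpow_le_rpow measureReal_nonneg (measureReal_mono (subset_univ s)) (by norm_num)

theorem norm_fst_le {E F : Type*} [NormedAddCommGroup E] [NormedAddCommGroup F]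
    (x : WithLp 2 (E × F)) : ‖x.ofLp.1‖ ≤ ‖x‖ := by
  rw [WithLp.prod_norm_eq_of_L2]
  exact Real.le_sqrt_of_sq_le (le_add_of_nonneg_right (sq_nonneg _))

theorem norm_snd_le {E F : Type*} [NormedAddCommGroup E] [NormedAddCommGroup F]
    (x : WithLp 2 (E × F)) : ‖x.ofLp.2‖ ≤ ‖x‖ := by
  rw [WithLp.prod_norm_eq_of_L2]
  exact Real.le_sqrt_of_sq_le (le_add_of_nonneg_left (sq_nonneg _))

theorem abs_int_le {S : ℝ} {g : ℝ → ℝ} (hg : MemLp g 2 (volume.restrict (Icc 0 S))) {t : ℝ}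
    (ht : t ∈ Icc 0 S) : |∫ s in (0 : ℝ)..t, g s| ≤
      ((volume.restrict (Icc 0 S)).real univ) ^ (1 / 2 : ℝ) * ‖hg.toLp g‖ := by
  have := abs_setIntegral_le hg (measurableSet_Ioc (a := (0 : ℝ)) (b := t))
  rwa [Measure.restrict_restrict_of_subset
    (Ioc_subset_Icc_self.trans (Icc_subset_Icc_right ht.2)),
    ← intervalIntegral.integral_of_le ht.1] at this

/-- A pointwise bound. -/
theorem WHat.bound : ∃ C : ℝ, 0 ≤ C ∧ ∀ f : WHat T, ∀ x ∈ Icc (0 : ℝ) 1, ∀ t ∈ Icc 0 T,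
    |f x t| ≤ C * ‖f‖ := by
  refine ⟨1 + ((volume.restrict (Icc (0 : ℝ) 1)).real univ) ^ (1 / 2 : ℝ)
    + ((volume.restrict (Icc (0 : ℝ) T)).real univ) ^ (1 / 2 : ℝ)
    + ((volume.restrict (Omega T)).real univ) ^ (1 / 2 : ℝ), by positivity,
    fun f x hx t ht => ?_⟩
  have h0 : ‖jet0 f‖ ≤ ‖f‖ := by rw [← norm_jetHat]; exact norm_snd_le (jetHat f)
  have hr : |f 0 0| ≤ ‖f‖ := by rw [← norm_jetHat]; exact norm_fst_le (jetHat f)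
  have ha : ‖f.rep.ra.1.toLp _‖ ≤ ‖f‖ := (norm_fst_le (jet0 f)).trans h0
  have h1 : ‖(jet0 f).ofLp.2‖ ≤ ‖f‖ := (norm_snd_le (jet0 f)).trans h0
  have hb : ‖f.rep.rb.1.toLp _‖ ≤ ‖f‖ := (norm_fst_le (jet0 f).ofLp.2).trans h1
  have hc : ‖f.rep.rc.1.toLp _‖ ≤ ‖f‖ := (norm_snd_le (jet0 f).ofLp.2).trans h1
  have ka := (abs_int_le f.rep.ra.1 hx).trans (mul_le_mul_of_nonneg_left ha (by positivity))
  have kb := (abs_int_le f.rep.rb.1 ht).trans (mul_le_mul_of_nonneg_left hb (by positivity))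
  have kc := (abs_setIntegral_le f.rep.rc.1
    ((measurableSet_Ioc (a := (0 : ℝ)) (b := x)).prod (measurableSet_Ioc (a := (0 : ℝ)) (b := t)))).trans
    (mul_le_mul_of_nonneg_left hc (by positivity))
  rw [Measure.restrict_restrict_of_subset (subOmega hx ht)] at kc
  rw [WHat.eq_of_jet f.rep hx ht]
  refine (abs_add_le _ _).trans ?_
  refine (add_le_add ((abs_add_le _ _).trans (add_le_add ((abs_add_le _ _).trans
    (add_le_add hr ka)) kb)) kc).trans (le_of_eq ?_)
  ring

end

abbrev res (S : ℝ) : Measure ℝ := volume.restrict (Icc (0 : ℝ) S)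

theorem slice_bound {A B : ℝ} {c : ℝ × ℝ → ℝ}
    (hc : MemLp c 2 ((res A).prod (res B))) :
    ∃ k : ℝ → ℝ, Integrable k (res A) ∧ ∀ᵐ y ∂(res A), ∀ s ∈ Icc 0 B,
      (∫ r in (0 : ℝ)..s, c (y, r)) ^ 2 ≤ k y := by
  have hsq : Integrable (fun z => c z ^ 2) ((res A).prod (res B)) := hc.integrable_sq
  refine ⟨fun y => ((res B).real univ ^ (1 / 2 : ℝ)) ^ 2 * ∫ r, c (y, r) ^ 2 ∂(res B),
    hsq.integral_prod_left.const_mul _, ?_⟩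
  filter_upwards [hsq.prod_right_ae, hc.1.prodMk_left] with y h1 h2 s hs
  have hm : MemLp (fun r => c (y, r)) 2 (res B) := (memLp_two_iff_integrable_sq h2).2 h1
  have h3 := abs_int_le hm hs
  have h4 : ‖hm.toLp _‖ ^ 2 = ∫ r, c (y, r) ^ 2 ∂(res B) := by
    rw [← real_inner_self_eq_norm_sq, inner_toLp]
    simp only [sq]
  rw [← h4, ← mul_pow, ← sq_abs]
  exact pow_le_pow_left₀ (abs_nonneg _) h3 2

theorem ae_prod_fst {A B : ℝ} {P : ℝ → Prop} (h : ∀ᵐ y ∂(res A), P y) :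
    ∀ᵐ z ∂((res A).prod (res B)), P z.1 ∧ z.2 ∈ Icc 0 B := by
  have h1 := (Measure.quasiMeasurePreserving_fst (μ := res A) (ν := res B)).ae h
  have h2 := (Measure.quasiMeasurePreserving_snd (μ := res A) (ν := res B)).ae
    (ae_restrict_mem measurableSet_Icc)
  exact h1.and h2

theorem memLp_prim {A B : ℝ} {c : ℝ × ℝ → ℝ} (hm : StronglyMeasurable c)
    (hc : MemLp c 2 ((res A).prod (res B))) :
    MemLp (fun z : ℝ × ℝ => ∫ r in (0 : ℝ)..z.2, c (z.1, r)) 2 ((res A).prod (res B)) := by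
  obtain ⟨k, hk, hb⟩ := slice_bound hc
  have hmeas : AEStronglyMeasurable (fun z : ℝ × ℝ => ∫ r in (0 : ℝ)..z.2, c (z.1, r))
      ((res A).prod (res B)) := by
    have h1 : StronglyMeasurable (fun q : (ℝ × ℝ) × ℝ =>
        {q : (ℝ × ℝ) × ℝ | 0 < q.2 ∧ q.2 ≤ q.1.2}.indicator (fun q => c (q.1.1, q.2)) q) := by
      refine (hm.comp_measurable (by fun_prop)).indicator ?_
      exact (measurableSet_lt measurable_const measurable_snd).inter
        (measurableSet_le measurable_snd (measurable_snd.comp measurable_fst))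
    have h2 := (h1.integral_prod_right' (ν := volume)).aestronglyMeasurable
      (μ := (res A).prod (res B))
    refine h2.congr ?_
    filter_upwards [ae_prod_fst (A := A) (B := B) (P := fun _ => True) (by simp)] with z hz
    rw [intervalIntegral.integral_of_le hz.2.1, ← integral_indicator measurableSet_Ioc]
    rfl
  rw [memLp_two_iff_integrable_sq hmeas]
  refine (hk.comp_fst (res B)).mono' (hmeas.pow 2) ?_
  filter_upwards [ae_prod_fst (B := B) hb] with z hz
  rw [Real.norm_of_nonneg (sq_nonneg _)]
  exact hz.1 z.2 hz.2

theorem memLp_trace {A B : ℝ} (hB : 0 ≤ B) {c : ℝ × ℝ → ℝ}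
    (hc : MemLp c 2 ((res A).prod (res B))) :
    MemLp (fun y => ∫ r in (0 : ℝ)..B, c (y, r)) 2 (res A) := by
  obtain ⟨k, hk, hb⟩ := slice_bound hc
  have hmeas : AEStronglyMeasurable (fun y => ∫ r in (0 : ℝ)..B, c (y, r)) (res A) := by
    refine hc.1.integral_prod_right'.congr (Eventually.of_forall fun y => ?_)
    beta_reduce
    rw [intervalIntegral.integral_of_le hB, ← integral_Icc_eq_integral_Ioc]
  rw [memLp_two_iff_integrable_sq hmeas]
  refine hk.mono' (hmeas.pow 2) ?_
  filter_upwards [hb] with z hz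
  rw [Real.norm_of_nonneg (sq_nonneg _)]
  exact hz B ⟨hB, le_rfl⟩

theorem memLp_swap {A B : ℝ} {c : ℝ × ℝ → ℝ} (hc : MemLp c 2 ((res A).prod (res B))) :
    MemLp (fun z : ℝ × ℝ => c z.swap) 2 ((res B).prod (res A)) :=
  hc.comp_measurePreserving Measure.measurePreserving_swap

theorem swap_int {T : ℝ} {c : ℝ × ℝ → ℝ} (hc : IntegrableOn c (Omega T)) {x t : ℝ}
    (hx : x ∈ Icc (0 : ℝ) 1) (ht : t ∈ Icc 0 T) :
    ∫ y in (0 : ℝ)..x, ∫ s in (0 : ℝ)..t, c (y, s) =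
      ∫ s in (0 : ℝ)..t, ∫ y in (0 : ℝ)..x, c (y, s) := by
  simp only [intervalIntegral.integral_of_le hx.1, intervalIntegral.integral_of_le ht.1]
  refine integral_integral_swap (f := fun y s => c (y, s)) ?_
  rw [Measure.prod_restrict, ← Measure.volume_eq_prod]
  exact hc.mono_set (subOmega hx ht)

theorem intInt_left {T : ℝ} {c : ℝ × ℝ → ℝ} (hc : IntegrableOn c (Omega T)) {x t : ℝ}
    (hx : x ∈ Icc (0 : ℝ) 1) (ht : t ∈ Icc 0 T) :
    IntervalIntegrable (fun y => ∫ s in (0 : ℝ)..t, c (y, s)) volume 0 x := by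
  rw [intervalIntegrable_iff_integrableOn_Ioc_of_le hx.1]
  have h : Integrable c ((volume.restrict (Ioc 0 x)).prod (volume.restrict (Ioc 0 t))) := by
    rw [Measure.prod_restrict, ← Measure.volume_eq_prod]
    exact hc.mono_set (subOmega hx ht)
  simp only [intervalIntegral.integral_of_le ht.1]
  exact h.integral_prod_left

theorem intInt_right {T : ℝ} {c : ℝ × ℝ → ℝ} (hc : IntegrableOn c (Omega T)) {x t : ℝ}
    (hx : x ∈ Icc (0 : ℝ) 1) (ht : t ∈ Icc 0 T) :
    IntervalIntegrable (fun s => ∫ y in (0 : ℝ)..x, c (y, s)) volume 0 t := by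
  rw [intervalIntegrable_iff_integrableOn_Ioc_of_le ht.1]
  have h : Integrable c ((volume.restrict (Ioc 0 x)).prod (volume.restrict (Ioc 0 t))) := by
    rw [Measure.prod_restrict, ← Measure.volume_eq_prod]
    exact hc.mono_set (subOmega hx ht)
  simp only [intervalIntegral.integral_of_le hx.1]
  exact h.integral_prod_right

theorem Rep2.exists_meas {T : ℝ} {f : ℝ → ℝ → ℝ} {a b : ℝ → ℝ} {c : ℝ × ℝ → ℝ}
    (h : Rep2 T f a b c) : ∃ c', StronglyMeasurable c' ∧ Rep2 T f a b c' := by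
  refine ⟨h.rc.1.1.mk c, h.rc.1.1.stronglyMeasurable_mk, h.ra, h.rb, ?_⟩
  have h1 : MemLp (h.rc.1.1.mk c) 2 (volume.restrict (Omega T)) := h.rc.1.ae_eq h.rc.1.1.ae_eq_mk
  refine ⟨h1, fun x hx t ht => ?_⟩
  rw [h.rc.2 x hx t ht, dbl (intOmega h1) hx ht, dbl (intOmega h.rc.1) hx ht]
  exact integral_congr_ae
    (ae_restrict_of_ae_restrict_of_subset (subOmega hx ht) h.rc.1.1.ae_eq_mk)

theorem memLp_cont {S : ℝ} {f : ℝ → ℝ} (hf : ContinuousOn f (Icc 0 S)) : MemLp f 2 (res S) := by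
  have hm : AEStronglyMeasurable f (res S) := hf.aestronglyMeasurable measurableSet_Icc
  rw [memLp_two_iff_integrable_sq hm]
  exact (hf.pow 2).integrableOn_compact isCompact_Icc

theorem Rep2.slice_x {T : ℝ} (hT : 0 ≤ T) {f : ℝ → ℝ → ℝ} {a b : ℝ → ℝ} {c : ℝ × ℝ → ℝ}
    (h : Rep2 T f a b c) {x : ℝ} (hx : x ∈ Icc (0 : ℝ) 1) : ContinuousOn (f x) (Icc 0 T) :=
  (h.continuousOn hT).comp (f := fun t => (x, t)) (by fun_prop) fun _ ht => ⟨hx, ht⟩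

theorem Rep2.slice_t {T : ℝ} (hT : 0 ≤ T) {f : ℝ → ℝ → ℝ} {a b : ℝ → ℝ} {c : ℝ × ℝ → ℝ}
    (h : Rep2 T f a b c) {t : ℝ} (ht : t ∈ Icc 0 T) : ContinuousOn (fun x => f x t) (Icc 0 1) :=
  (h.continuousOn hT).comp (f := fun x => (x, t)) (by fun_prop) fun _ hx => ⟨hx, ht⟩

theorem memAC2_Vt {T : ℝ} (hT : 0 ≤ T) {f : ℝ → ℝ → ℝ} (hf : MemAC2 T f) :
    MemAC2 T (fun x t => ∫ s in (0 : ℝ)..t, f x s) := by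
  obtain ⟨c, hcm, h⟩ := hf.rep.exists_meas
  set a := deriv fun x => f x 0
  have hc := h.rc.1
  have hmem : MemLp (fun z : ℝ × ℝ => a z.1 + ∫ r in (0 : ℝ)..z.2, c (z.1, r)) 2
      (volume.restrict (Omega T)) := by
    rw [restrict_Omega] at hc ⊢
    exact (h.ra.1.comp_fst _).add (memLp_prim hcm hc)
  refine Rep2.memAC2 hT (a := fun _ => 0) (b := f 0)
    ⟨⟨MemLp.zero, by simp⟩, ⟨memLp_cont (h.slice_x hT (by simp)), by simp⟩, hmem,
      fun x hx t ht => ?_⟩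
  rw [swap_int (intOmega hmem) hx ht]
  simp only [intervalIntegral.integral_same, sub_zero, add_zero]
  have hi : ∀ {x}, x ∈ Icc (0 : ℝ) 1 → IntervalIntegrable (f x) volume 0 t := fun hx =>
    intInt (memLp_cont (h.slice_x hT hx)) ht
  rw [← intervalIntegral.integral_sub (hi hx) (hi (by simp))]
  refine intervalIntegral.integral_congr fun s hs => ?_
  rw [uIcc_of_le ht.1] at hs
  have hs' : s ∈ Icc 0 T := ⟨hs.1, hs.2.trans ht.2⟩
  rw [intervalIntegral.integral_add (intInt h.ra.1 hx) (intInt_left (intOmega hc) hx hs'),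
    ← h.rc.2 x hx s hs']
  have := h.ra.2 x hx
  linarith

theorem memAC2_Vx {T : ℝ} (hT : 0 ≤ T) {f : ℝ → ℝ → ℝ} (hf : MemAC2 T f) :
    MemAC2 T (fun x t => ∫ y in (0 : ℝ)..x, f y t) := by
  obtain ⟨c, hcm, h⟩ := hf.rep.exists_meas
  set b := deriv (f 0)
  have hc := h.rc.1
  have hmem : MemLp (fun z : ℝ × ℝ => b z.2 + ∫ r in (0 : ℝ)..z.1, c (r, z.2)) 2
      (volume.restrict (Omega T)) := by
    rw [restrict_Omega] at hc ⊢
    have h1 := memLp_swap (memLp_prim (hcm.comp_measurable measurable_swap) (memLp_swap hc))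
    exact (h.rb.1.comp_snd _).add h1
  have h0 : (0 : ℝ) ∈ Icc 0 T := ⟨le_rfl, hT⟩
  refine Rep2.memAC2 hT (a := fun x => f x 0) (b := fun _ => 0)
    ⟨⟨memLp_cont (h.slice_t hT h0), by simp⟩, ⟨MemLp.zero, by simp⟩, hmem,
      fun x hx t ht => ?_⟩
  simp only [intervalIntegral.integral_same, sub_zero, add_zero]
  have hi : ∀ {t}, t ∈ Icc 0 T → IntervalIntegrable (fun x => f x t) volume 0 x := fun ht =>
    intInt (memLp_cont (h.slice_t hT ht)) hx
  rw [← intervalIntegral.integral_sub (hi ht) (hi h0)]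
  refine intervalIntegral.integral_congr fun y hy => ?_
  rw [uIcc_of_le hx.1] at hy
  have hy' : y ∈ Icc (0 : ℝ) 1 := ⟨hy.1, hy.2.trans hx.2⟩
  rw [intervalIntegral.integral_add (intInt h.rb.1 ht) (intInt_right (intOmega hc) hy' ht),
    ← swap_int (intOmega hc) hy' ht, ← h.rc.2 y hy' t ht]
  have := h.rb.2 t ht
  linarith

theorem rep_trace {T : ℝ} {f : ℝ → ℝ → ℝ} (hf : MemAC2 T f) :
    ∃ q, Rep T (f 1) q := by
  obtain ⟨c, hcm, h⟩ := hf.rep.exists_meas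
  have hc := h.rc.1
  rw [restrict_Omega] at hc
  refine ⟨fun s => deriv (f 0) s + ∫ y in (0 : ℝ)..1, c (y, s),
    h.rb.1.add (memLp_trace zero_le_one (memLp_swap hc)), fun t ht => ?_⟩
  have h1 : (1 : ℝ) ∈ Icc (0 : ℝ) 1 := by simp
  rw [intervalIntegral.integral_add (intInt h.rb.1 ht) (intInt_right (intOmega h.rc.1) h1 ht),
    ← swap_int (intOmega h.rc.1) h1 ht, ← h.rc.2 1 h1 t ht]
  have := h.rb.2 t ht
  linarith

theorem memAC2_xp {T : ℝ} (hT : 0 ≤ T) {p q : ℝ → ℝ} (hp : Rep T p q) :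
    MemAC2 T (fun x t => x * p t) := by
  have hq : MemLp (fun z : ℝ × ℝ => q z.2) 2 (volume.restrict (Omega T)) := by
    rw [restrict_Omega]; exact hp.1.comp_snd _
  refine Rep2.memAC2 hT (a := fun _ => p 0) (b := fun _ => 0)
    ⟨⟨memLp_cont continuousOn_const, by simp⟩, ⟨MemLp.zero, by simp⟩, hq, fun x hx t ht => ?_⟩
  simp only [intervalIntegral.integral_const, smul_eq_mul, hp.2 t ht]
  ring

section

/-- The partial derivative `∂/∂x` on `Ω` (one-sided at `x = 0` and `x = 1`). -/
def dx (u : ℝ → ℝ → ℝ) : ℝ → ℝ → ℝ := fun x t => derivWithin (fun y => u y t) (Icc 0 1) x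

/-- The partial derivative `∂/∂t` on `Ω` (one-sided at `t = 0` and `t = T`). -/
def dt (T : ℝ) (u : ℝ → ℝ → ℝ) : ℝ → ℝ → ℝ := fun x t => derivWithin (u x) (Icc 0 T) t

/-- The functions `U i j`, `i, j ≤ 2`, are the partial derivatives `∂^{i+j}u/∂x^i∂t^j` on `Ω`, which
exist in every order of differentiation. -/
structure IsJet (T : ℝ) (u : ℝ → ℝ → ℝ) (U : ℕ → ℕ → ℝ → ℝ → ℝ) : Prop where
  zero : ∀ x ∈ Icc (0 : ℝ) 1, ∀ t ∈ Icc 0 T, U 0 0 x t = u x t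
  hasDeriv_x : ∀ i < 2, ∀ j ≤ 2, ∀ x ∈ Icc (0 : ℝ) 1, ∀ t ∈ Icc 0 T,
    HasDerivWithinAt (fun y => U i j y t) (U (i + 1) j x t) (Icc 0 1) x
  hasDeriv_t : ∀ i ≤ 2, ∀ j < 2, ∀ x ∈ Icc (0 : ℝ) 1, ∀ t ∈ Icc 0 T,
    HasDerivWithinAt (U i j x) (U i (j + 1) x t) (Icc 0 T) t

/-- Membership in `W(Ω)`: the derivative `∂⁴u/∂x²∂t²` exists, is completely continuous on `Ω` with
square integrable densities (in particular `∂⁶u/∂x³∂t³ ∈ L²(Ω)`), and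
`u(x,0) = ∂u/∂t(x,0) = u(0,t) = u(1,t) = 0`. As above, `u` is extended by zero outside `Ω`. -/
def MemW (T : ℝ) (u : ℝ → ℝ → ℝ) : Prop :=
  (∀ x t, (x, t) ∉ Omega T → u x t = 0) ∧ (∃ U, IsJet T u U) ∧
    MemAC2 T (dx^[2] ((dt T)^[2] u)) ∧
    (∀ x ∈ Icc (0 : ℝ) 1, u x 0 = 0) ∧ (∀ x ∈ Icc (0 : ℝ) 1, dt T u x 0 = 0) ∧
    (∀ t ∈ Icc 0 T, u 0 t = 0) ∧ (∀ t ∈ Icc 0 T, u 1 t = 0)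

/-- The inner product of `W_2^3[0,1]`:
`f(0)g(0) + f'(0)g'(0) + f'(1)g'(1) + ∫₀¹ f'''g'''`. -/
def innerW23 (f g : ℝ → ℝ) : ℝ :=
  let d : (ℝ → ℝ) → ℝ → ℝ := fun h => derivWithin h (Icc 0 1)
  f 0 * g 0 + d f 0 * d g 0 + d f 1 * d g 1 +
    ∫ x in (0 : ℝ)..1, deriv (d (d f)) x * deriv (d (d g)) x

/-- The inner product of `W(Ω)`. Here `∂³/∂t³ ∂^i/∂x^i u(0,·)` is the almost everywhere derivative of
`∂²/∂t² ∂^i/∂x^i u(0,·)`, and `∂⁶u/∂x³∂t³` is the mixed derivative of `∂⁴u/∂x²∂t²`. -/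
def innerW (T : ℝ) (u g : ℝ → ℝ → ℝ) : ℝ :=
  (∑ i ∈ Finset.range 3, ∫ t in (0 : ℝ)..T,
      deriv ((dt T)^[2] (dx^[i] u) 0) t * deriv ((dt T)^[2] (dx^[i] g) 0) t)
    + (∑ j ∈ Finset.range 3,
      innerW23 (fun x => (dt T)^[j] u x 0) (fun x => (dt T)^[j] g x 0))
    + ∫ x in (0 : ℝ)..1, ∫ t in (0 : ℝ)..T,
      dxt T (dx^[2] ((dt T)^[2] u)) (x, t) * dxt T (dx^[2] ((dt T)^[2] g)) (x, t)

/-- Auxiliary: `∂^{i+j}u/∂x^i∂t^j`. -/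
def pd (T : ℝ) (u : ℝ → ℝ → ℝ) (i j : ℕ) : ℝ → ℝ → ℝ := dx^[i] ((dt T)^[j] u)

variable {T : ℝ}

theorem zmem1 : (0 : ℝ) ∈ Icc (0 : ℝ) 1 := by simp
theorem omem1 : (1 : ℝ) ∈ Icc (0 : ℝ) 1 := by simp

theorem IsJet.pd_eq (hT : 0 < T) {u : ℝ → ℝ → ℝ} {U : ℕ → ℕ → ℝ → ℝ → ℝ} (h : IsJet T u U)
    {i j : ℕ} (hi : i ≤ 2) (hj : j ≤ 2) : ∀ x ∈ Icc (0 : ℝ) 1, ∀ t ∈ Icc 0 T,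
      pd T u i j x t = U i j x t := by
  induction i with
  | zero =>
    induction j with
    | zero => intro x hx t ht; exact (h.zero x hx t ht).symm
    | succ j ih =>
      intro x hx t ht
      have ih := ih (by omega)
      simp only [pd, Function.iterate_zero, id, Function.iterate_succ_apply'] at ih ⊢
      have h1 := (h.hasDeriv_t 0 (by omega) j (by omega) x hx t ht).congr
        (fun s hs => ih x hx s hs) (ih x hx t ht)
      exact h1.derivWithin (uniqueDiffOn_Icc hT t ht)
  | succ i ih =>
    intro x hx t ht
    have ih := ih (by omega)
    simp only [pd, Function.iterate_succ_apply'] at ih ⊢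
    have h1 := (h.hasDeriv_x i (by omega) j hj x hx t ht).congr
      (fun s hs => ih s hs t ht) (ih x hx t ht)
    exact h1.derivWithin (uniqueDiffOn_Icc one_pos x hx)

theorem IsJet.pd_eq' (hT : 0 < T) {u : ℝ → ℝ → ℝ} {U : ℕ → ℕ → ℝ → ℝ → ℝ} (h : IsJet T u U)
    {i j : ℕ} (hi : i ≤ 2) (hj : j ≤ 2) : ∀ x ∈ Icc (0 : ℝ) 1, ∀ t ∈ Icc 0 T,
      (dt T)^[j] (dx^[i] u) x t = U i j x t := by
  induction j with
  | zero =>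
    induction i with
    | zero => intro x hx t ht; exact (h.zero x hx t ht).symm
    | succ i ih =>
      intro x hx t ht
      have ih := ih (by omega)
      simp only [Function.iterate_zero, id, Function.iterate_succ_apply'] at ih ⊢
      have h1 := (h.hasDeriv_x i (by omega) 0 (by omega) x hx t ht).congr
        (fun s hs => ih s hs t ht) (ih x hx t ht)
      exact h1.derivWithin (uniqueDiffOn_Icc one_pos x hx)
  | succ j ih =>
    intro x hx t ht
    have ih := ih (by omega)
    simp only [Function.iterate_succ_apply'] at ih ⊢
    have h1 := (h.hasDeriv_t i hi j (by omega) x hx t ht).congr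
      (fun s hs => ih x hx s hs) (ih x hx t ht)
    exact h1.derivWithin (uniqueDiffOn_Icc hT t ht)

theorem IsJet.canon (hT : 0 < T) {u : ℝ → ℝ → ℝ} {U : ℕ → ℕ → ℝ → ℝ → ℝ} (h : IsJet T u U) :
    IsJet T u (pd T u) := by
  refine ⟨fun x _ t _ => rfl, fun i hi j hj x hx t ht => ?_, fun i hi j hj x hx t ht => ?_⟩
  · rw [h.pd_eq hT (i := i + 1) (by omega) hj x hx t ht]
    exact (h.hasDeriv_x i hi j hj x hx t ht).congr
      (fun s hs => h.pd_eq hT hi.le hj s hs t ht) (h.pd_eq hT hi.le hj x hx t ht)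
  · rw [h.pd_eq hT (j := j + 1) hi (by omega) x hx t ht]
    exact (h.hasDeriv_t i hi j hj x hx t ht).congr
      (fun s hs => h.pd_eq hT hi hj.le x hx s hs) (h.pd_eq hT hi hj.le x hx t ht)

theorem IsJet.add {u v : ℝ → ℝ → ℝ} {U V : ℕ → ℕ → ℝ → ℝ → ℝ} (h : IsJet T u U)
    (h' : IsJet T v V) : IsJet T (u + v) (fun i j x t => U i j x t + V i j x t) :=
  ⟨fun x hx t ht => by simp [h.zero x hx t ht, h'.zero x hx t ht],
    fun i hi j hj x hx t ht => (h.hasDeriv_x i hi j hj x hx t ht).add (h'.hasDeriv_x i hi j hj x hx t ht),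
    fun i hi j hj x hx t ht => (h.hasDeriv_t i hi j hj x hx t ht).add (h'.hasDeriv_t i hi j hj x hx t ht)⟩

theorem IsJet.smul {u : ℝ → ℝ → ℝ} {U : ℕ → ℕ → ℝ → ℝ → ℝ} (r : ℝ) (h : IsJet T u U) :
    IsJet T (r • u) (fun i j x t => r * U i j x t) :=
  ⟨fun x hx t ht => by simp [h.zero x hx t ht],
    fun i hi j hj x hx t ht => (h.hasDeriv_x i hi j hj x hx t ht).const_mul r,
    fun i hi j hj x hx t ht => (h.hasDeriv_t i hi j hj x hx t ht).const_mul r⟩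

theorem MemW.jet (hT : 0 < T) {u : ℝ → ℝ → ℝ} (h : MemW T u) : IsJet T u (pd T u) := by
  obtain ⟨U, hU⟩ := h.2.1
  exact hU.canon hT

theorem memAC2_zero (hT : 0 ≤ T) : MemAC2 T (fun _ _ => 0) := by
  have hr : ∀ S : ℝ, Rep S (fun _ => 0) (fun _ => 0) := fun S => ⟨MemLp.zero, by simp⟩
  exact Rep2.memAC2 hT (a := fun _ => 0) (b := fun _ => 0) (c := fun _ => 0)
      ⟨hr 1, hr T, MemLp.zero, by simp⟩

/-- The space `W(Ω)` as a linear space of functions. -/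
def WSub (T : ℝ) [Fact (0 < T)] : Submodule ℝ (ℝ → ℝ → ℝ) where
  carrier := {u | MemW T u}
  add_mem' := fun {u v} hu hv => by
    have hJ := (hu.jet pos).add (hv.jet pos)
    have h0 : (0 : ℝ) ∈ Icc 0 T := ⟨le_rfl, pos.le⟩
    refine ⟨fun x t h => by simp [hu.1 x t h, hv.1 x t h], ⟨_, hJ⟩,
      (hu.2.2.1.add pos.le hv.2.2.1).congr pos.le fun x hx t ht =>
        hJ.pd_eq pos le_rfl le_rfl x hx t ht,
      fun x hx => by simp [hu.2.2.2.1 x hx, hv.2.2.2.1 x hx], fun x hx => ?_,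
      fun t ht => by simp [hu.2.2.2.2.2.1 t ht, hv.2.2.2.2.2.1 t ht],
      fun t ht => by simp [hu.2.2.2.2.2.2 t ht, hv.2.2.2.2.2.2 t ht]⟩
    have := hJ.pd_eq pos (i := 0) (j := 1) (by simp) (by simp) x hx 0 h0
    refine this.trans ?_
    have e1 : pd T u 0 1 x 0 = 0 := hu.2.2.2.2.1 x hx
    have e2 : pd T v 0 1 x 0 = 0 := hv.2.2.2.2.1 x hx
    rw [e1, e2, add_zero]
  zero_mem' := by
    have hJ : IsJet T 0 (fun _ _ _ _ => 0) := ⟨fun x _ t _ => rfl,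
      fun i _ j _ x _ t _ => hasDerivWithinAt_const x _ (0 : ℝ),
      fun i _ j _ x _ t _ => hasDerivWithinAt_const t _ (0 : ℝ)⟩
    have h0 : (0 : ℝ) ∈ Icc 0 T := ⟨le_rfl, pos.le⟩
    exact ⟨fun _ _ _ => rfl, ⟨_, hJ⟩, (memAC2_zero pos.le).congr pos.le fun x hx t ht =>
        hJ.pd_eq pos le_rfl le_rfl x hx t ht, fun _ _ => rfl,
      fun x hx => hJ.pd_eq pos (i := 0) (j := 1) (by simp) (by simp) x hx 0 h0,
      fun _ _ => rfl, fun _ _ => rfl⟩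
  smul_mem' := fun r u hu => by
    have hJ := (hu.jet pos).smul r
    have h0 : (0 : ℝ) ∈ Icc 0 T := ⟨le_rfl, pos.le⟩
    refine ⟨fun x t h => by simp [hu.1 x t h], ⟨_, hJ⟩,
      (hu.2.2.1.smul pos.le r).congr pos.le fun x hx t ht =>
        hJ.pd_eq pos le_rfl le_rfl x hx t ht,
      fun x hx => by simp [hu.2.2.2.1 x hx], fun x hx => ?_,
      fun t ht => by simp [hu.2.2.2.2.2.1 t ht],
      fun t ht => by simp [hu.2.2.2.2.2.2 t ht]⟩
    have := hJ.pd_eq pos (i := 0) (j := 1) (by simp) (by simp) x hx 0 h0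
    refine this.trans ?_
    have e1 : pd T u 0 1 x 0 = 0 := hu.2.2.2.2.1 x hx
    rw [e1, mul_zero]

/-- The space `W(Ω)` as a type of its own; it carries the norm topology of `innerW`. -/
def W (T : ℝ) [Fact (0 < T)] : Type := WSub T

variable [Fact (0 < T)]

instance : AddCommGroup (W T) := inferInstanceAs (AddCommGroup (WSub T))
instance : Module ℝ (W T) := inferInstanceAs (Module ℝ (WSub T))
/-- The underlying function. -/
def W.fn (f : W T) : ℝ → ℝ → ℝ := f.1
instance : CoeFun (W T) (fun _ => ℝ → ℝ → ℝ) := ⟨W.fn⟩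

theorem zmemT : (0 : ℝ) ∈ Icc (0 : ℝ) T := ⟨le_rfl, pos.le⟩

theorem W.jet (u : W T) : IsJet T u (pd T u) := MemW.jet pos u.2

theorem W.pd_add (u v : W T) {i j : ℕ} (hi : i ≤ 2) (hj : j ≤ 2) {x t : ℝ}
    (hx : x ∈ Icc (0 : ℝ) 1) (ht : t ∈ Icc 0 T) :
    pd T (u + v : W T) i j x t = pd T u i j x t + pd T v i j x t :=
  (u.jet.add v.jet).pd_eq pos hi hj x hx t ht

theorem W.pd_smul (r : ℝ) (u : W T) {i j : ℕ} (hi : i ≤ 2) (hj : j ≤ 2) {x t : ℝ}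
    (hx : x ∈ Icc (0 : ℝ) 1) (ht : t ∈ Icc 0 T) :
    pd T (r • u : W T) i j x t = r * pd T u i j x t :=
  (u.jet.smul r).pd_eq pos hi hj x hx t ht

theorem W.ext {f g : W T} (h : ∀ x ∈ Icc (0 : ℝ) 1, ∀ t ∈ Icc 0 T, f x t = g x t) : f = g := by
  apply Subtype.ext
  funext x t
  by_cases hx : (x, t) ∈ Omega T
  · exact h x hx.1 t hx.2
  · exact (f.2.1 x t hx).trans (g.2.1 x t hx).symm

/-! structure of elements of W -/

theorem ftc {S : ℝ} {F G : ℝ → ℝ} (h : ∀ x ∈ Icc 0 S, HasDerivWithinAt F (G x) (Icc 0 S) x)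
    (hG : ContinuousOn G (Icc 0 S)) {x : ℝ} (hx : x ∈ Icc 0 S) :
    F x = F 0 + ∫ y in (0 : ℝ)..x, G y := by
  have h1 : ∫ y in (0 : ℝ)..x, G y = F x - F 0 := by
    refine intervalIntegral.integral_eq_sub_of_hasDerivAt_of_le hx.1 ?_ ?_
      (intInt (memLp_cont hG) hx)
    · exact fun y hy => ((h y ⟨hy.1, hy.2.trans hx.2⟩).continuousWithinAt).mono
        (Icc_subset_Icc_right hx.2)
    · exact fun y hy => (h y ⟨hy.1.le, hy.2.le.trans hx.2⟩).hasDerivAt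
        (Icc_mem_nhds hy.1 (hy.2.trans_le hx.2))
  linarith

theorem deriv_zero {S : ℝ} (hS : 0 < S) {F : ℝ → ℝ} {d x : ℝ} (hx : x ∈ Icc 0 S)
    (h : HasDerivWithinAt F d (Icc 0 S) x) (hF : ∀ y ∈ Icc 0 S, F y = 0) : d = 0 := by
  have h2 : HasDerivWithinAt F 0 (Icc 0 S) x :=
    (hasDerivWithinAt_const x _ (0 : ℝ)).congr hF (hF x hx)
  exact (uniqueDiffOn_Icc hS x hx).eq_deriv _ h h2

section structureLemmas
variable (u : W T)

theorem W.bc_x0 {x : ℝ} (hx : x ∈ Icc (0 : ℝ) 1) : pd T u 0 0 x 0 = 0 := u.2.2.2.2.1 x hx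
theorem W.bc_dt {x : ℝ} (hx : x ∈ Icc (0 : ℝ) 1) : pd T u 0 1 x 0 = 0 := u.2.2.2.2.2.1 x hx
theorem W.bc_0t {t : ℝ} (ht : t ∈ Icc 0 T) : pd T u 0 0 0 t = 0 := u.2.2.2.2.2.2.1 t ht
theorem W.bc_1t {t : ℝ} (ht : t ∈ Icc 0 T) : pd T u 0 0 1 t = 0 := u.2.2.2.2.2.2.2 t ht

theorem W.pd_side {a : ℝ} (ha : a ∈ Icc (0 : ℝ) 1) (h : ∀ t ∈ Icc 0 T, pd T u 0 0 a t = 0)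
    {j : ℕ} (hj : j ≤ 2) : ∀ t ∈ Icc 0 T, pd T u 0 j a t = 0 := by
  induction j with
  | zero => exact h
  | succ j ih =>
    intro t ht
    exact deriv_zero pos ht (u.jet.hasDeriv_t 0 (by simp) j (by omega) a ha t ht) (ih (by omega))

theorem W.pd_bot {j : ℕ} (hj : j ≤ 1) {i : ℕ} (hi : i ≤ 2) :
    ∀ x ∈ Icc (0 : ℝ) 1, pd T u i j x 0 = 0 := by
  induction i with
  | zero =>
    intro x hx
    interval_cases j
    · exact u.bc_x0 hx
    · exact u.bc_dt hx
  | succ i ih =>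
    intro x hx
    exact deriv_zero one_pos hx (u.jet.hasDeriv_x i (by omega) j (by omega) x hx 0 zmemT)
      (ih (by omega))

theorem W.memAC2 : MemAC2 T (pd T u 2 2) := u.2.2.2.1

theorem W.w_slice_x {x : ℝ} (hx : x ∈ Icc (0 : ℝ) 1) : ContinuousOn (pd T u 2 2 x) (Icc 0 T) :=
  u.memAC2.rep.slice_x pos.le hx

theorem W.w_slice_t {t : ℝ} (ht : t ∈ Icc 0 T) :
    ContinuousOn (fun x => pd T u 2 2 x t) (Icc 0 1) :=
  u.memAC2.rep.slice_t pos.le ht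

theorem W.s12 {x t : ℝ} (hx : x ∈ Icc (0 : ℝ) 1) (ht : t ∈ Icc 0 T) :
    pd T u 1 2 x t = pd T u 1 2 0 t + ∫ y in (0 : ℝ)..x, pd T u 2 2 y t :=
  ftc (F := fun x => pd T u 1 2 x t)
    (fun y hy => u.jet.hasDeriv_x 1 (by simp) 2 le_rfl y hy t ht) (u.w_slice_t ht) hx

theorem W.s02 {x t : ℝ} (hx : x ∈ Icc (0 : ℝ) 1) (ht : t ∈ Icc 0 T) :
    pd T u 0 2 x t = x * pd T u 1 2 0 t +
      ∫ y in (0 : ℝ)..x, ∫ z in (0 : ℝ)..y, pd T u 2 2 z t := by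
  have hc : ContinuousOn (fun x => pd T u 1 2 x t) (Icc 0 1) := fun y hy =>
    (u.jet.hasDeriv_x 1 (by simp) 2 le_rfl y hy t ht).continuousWithinAt
  have h1 := ftc (F := fun x => pd T u 0 2 x t)
    (fun y hy => u.jet.hasDeriv_x 0 (by simp) 2 le_rfl y hy t ht) hc hx
  have h0 : pd T u 0 2 0 t = 0 := u.pd_side zmem1 (fun t ht => u.bc_0t ht) le_rfl t ht
  simp only [h0, zero_add] at h1
  rw [h1]
  have h2 : ∫ y in (0 : ℝ)..x, pd T u 1 2 y t = ∫ y in (0 : ℝ)..x,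
      (pd T u 1 2 0 t + ∫ z in (0 : ℝ)..y, pd T u 2 2 z t) := by
    refine intervalIntegral.integral_congr fun y hy => ?_
    rw [uIcc_of_le hx.1] at hy
    exact u.s12 ⟨hy.1, hy.2.trans hx.2⟩ ht
  have hc2 : ContinuousOn (fun y => ∫ z in (0 : ℝ)..y, pd T u 2 2 z t) (Icc 0 1) := by
    refine (hc.sub (continuousOn_const (c := pd T u 1 2 0 t))).congr fun y hy => ?_
    simp only [Pi.sub_apply]
    rw [u.s12 hy ht]; ring
  rw [h2, intervalIntegral.integral_add intervalIntegrable_const (intInt (memLp_cont hc2) hx)]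
  simp

theorem W.s_p {t : ℝ} (ht : t ∈ Icc 0 T) : pd T u 1 2 0 t =
    - ∫ y in (0 : ℝ)..1, ∫ z in (0 : ℝ)..y, pd T u 2 2 z t := by
  have h1 := u.s02 omem1 ht
  rw [u.pd_side omem1 (fun t ht => u.bc_1t ht) le_rfl t ht] at h1
  linarith

theorem W.s20 {x t : ℝ} (hx : x ∈ Icc (0 : ℝ) 1) (ht : t ∈ Icc 0 T) :
    pd T u 2 0 x t = ∫ s in (0 : ℝ)..t, ∫ r in (0 : ℝ)..s, pd T u 2 2 x r := by
  have h21 : ∀ s ∈ Icc 0 T, pd T u 2 1 x s = ∫ r in (0 : ℝ)..s, pd T u 2 2 x r := fun s hs => by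
    have := ftc (fun s hs => u.jet.hasDeriv_t 2 le_rfl 1 (by simp) x hx s hs) (u.w_slice_x hx) hs
    rwa [u.pd_bot le_rfl le_rfl x hx, zero_add] at this
  have hc : ContinuousOn (pd T u 2 1 x) (Icc 0 T) := fun s hs =>
    (u.jet.hasDeriv_t 2 le_rfl 1 (by simp) x hx s hs).continuousWithinAt
  have := ftc (fun s hs => u.jet.hasDeriv_t 2 le_rfl 0 (by simp) x hx s hs) hc ht
  rw [u.pd_bot (by simp) le_rfl x hx, zero_add] at this
  rw [this]
  refine intervalIntegral.integral_congr fun s hs => ?_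
  rw [uIcc_of_le ht.1] at hs
  exact h21 s ⟨hs.1, hs.2.trans ht.2⟩

theorem W.eq_zero (h : ∀ x ∈ Icc (0 : ℝ) 1, ∀ t ∈ Icc 0 T, pd T u 2 2 x t = 0) : u = 0 := by
  have hint : ∀ t ∈ Icc 0 T, ∀ x ∈ Icc (0 : ℝ) 1,
      ∫ y in (0 : ℝ)..x, ∫ z in (0 : ℝ)..y, pd T u 2 2 z t = 0 := fun t ht x hx => by
    rw [intervalIntegral.integral_congr (g := fun _ => 0), intervalIntegral.integral_zero]
    intro y hy
    rw [uIcc_of_le hx.1] at hy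
    beta_reduce
    rw [intervalIntegral.integral_congr (g := fun _ => 0), intervalIntegral.integral_zero]
    intro z hz
    rw [uIcc_of_le hy.1] at hz
    exact h z ⟨hz.1, hz.2.trans (hy.2.trans hx.2)⟩ t ht
  have h02 : ∀ x ∈ Icc (0 : ℝ) 1, ∀ t ∈ Icc 0 T, pd T u 0 2 x t = 0 := fun x hx t ht => by
    rw [u.s02 hx ht, u.s_p ht, hint t ht 1 omem1, hint t ht x hx]; simp
  have h01 : ∀ x ∈ Icc (0 : ℝ) 1, ∀ t ∈ Icc 0 T, pd T u 0 1 x t = 0 := fun x hx t ht => by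
    have := ftc (G := fun _ => 0) (fun s hs => by
      have := u.jet.hasDeriv_t 0 (by simp) 1 (by simp) x hx s hs
      rwa [h02 x hx s hs] at this) continuousOn_const ht
    rw [this, u.bc_dt hx]; simp
  refine W.ext fun x hx t ht => ?_
  have := ftc (G := fun _ => 0) (fun s hs => by
      have := u.jet.hasDeriv_t 0 (by simp) 0 (by simp) x hx s hs
      rwa [h01 x hx s hs] at this) continuousOn_const ht
  rw [u.bc_x0 hx] at this
  have e : pd T u 0 0 x t = 0 := by simpa using this
  exact e

end structureLemmas

/-- Auxiliary: `u ↦ ∂⁴u/∂x²∂t²` from `W(Ω)` to `Ŵ(Ω)`. -/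
def W.D : W T →ₗ[ℝ] WHat T where
  toFun u := WHat.mk' (pd T u 2 2) u.memAC2
  map_add' u v := WHat.ext fun x hx t ht => by
    rw [WHat.mk'_apply hx ht, W.pd_add u v le_rfl le_rfl hx ht]
    exact (congrArg₂ (· + ·) (WHat.mk'_apply hx ht) (WHat.mk'_apply hx ht)).symm
  map_smul' r u := WHat.ext fun x hx t ht => by
    rw [WHat.mk'_apply hx ht, W.pd_smul r u le_rfl le_rfl hx ht]
    exact (congrArg (r * ·) (WHat.mk'_apply hx ht)).symm

theorem W.D_apply (u : W T) {x t : ℝ} (hx : x ∈ Icc (0 : ℝ) 1) (ht : t ∈ Icc 0 T) :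
    W.D u x t = pd T u 2 2 x t := WHat.mk'_apply (hf := u.memAC2) hx ht

end

section

variable {T : ℝ} [Fact (0 < T)]

theorem deriv_congr_Ioo {S : ℝ} {f f' : ℝ → ℝ} (h : ∀ x ∈ Icc 0 S, f x = f' x) {x : ℝ}
    (hx : x ∈ Ioo 0 S) : deriv f x = deriv f' x := by
  refine Filter.EventuallyEq.deriv_eq ?_
  filter_upwards [Ioo_mem_nhds hx.1 hx.2] with y hy
  exact h y (Ioo_subset_Icc_self hy)

theorem int_deriv_congr {S : ℝ} (hS : 0 ≤ S) {f f' g g' : ℝ → ℝ} (h : ∀ x ∈ Icc 0 S, f x = f' x)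
    (h' : ∀ x ∈ Icc 0 S, g x = g' x) :
    ∫ x in (0 : ℝ)..S, deriv f x * deriv g x = ∫ x in (0 : ℝ)..S, deriv f' x * deriv g' x := by
  rw [intervalIntegral.integral_of_le hS, intervalIntegral.integral_of_le hS,
    integral_Ioc_eq_integral_Ioo, integral_Ioc_eq_integral_Ioo]
  refine setIntegral_congr_fun measurableSet_Ioo fun x hx => ?_
  simp only [deriv_congr_Ioo h hx, deriv_congr_Ioo h' hx]

theorem int_deriv_zero {S : ℝ} (hS : 0 ≤ S) {f g : ℝ → ℝ} (h : ∀ x ∈ Icc 0 S, f x = 0) :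
    ∫ x in (0 : ℝ)..S, deriv f x * deriv g x = 0 := by
  rw [int_deriv_congr hS (f' := fun _ => 0) (g' := g) h (fun _ _ => rfl)]
  simp

theorem dW_zero {f : ℝ → ℝ} (h : ∀ x ∈ Icc (0 : ℝ) 1, f x = 0) :
    ∀ x ∈ Icc (0 : ℝ) 1, derivWithin f (Icc 0 1) x = 0 := fun x hx =>
  ((hasDerivWithinAt_const x _ (0 : ℝ)).congr h (h x hx)).derivWithin
    (uniqueDiffOn_Icc one_pos x hx)

theorem innerW23_zero {f g : ℝ → ℝ} (h : ∀ x ∈ Icc (0 : ℝ) 1, f x = 0) : innerW23 f g = 0 := by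
  have h1 := dW_zero h
  have h2 := dW_zero h1
  simp only [innerW23]
  rw [h 0 zmem1, h1 0 zmem1, h1 1 omem1, int_deriv_zero zero_le_one h2]
  ring

theorem D_rep (u : W T) : Rep2 T (pd T u 2 2) (deriv fun x => W.D u x 0) (deriv (W.D u 0))
    (dxt T (W.D u)) :=
  (W.D u).rep.congr pos.le fun _ hx _ ht => (W.D_apply u hx ht).symm

theorem innerW_eq0 (u g : W T) : innerW T u g =
    (∫ t in (0 : ℝ)..T, deriv (pd T u 1 2 0) t * deriv (pd T g 1 2 0) t)
    + (pd T u 1 2 0 0 * pd T g 1 2 0 0 + (pd T u 1 2 1 0 * pd T g 1 2 1 0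
    + inner ℝ (jet0 (W.D u)) (jet0 (W.D g)))) := by
  have hi : ∀ i ≤ 2, ∫ t in (0 : ℝ)..T,
      deriv ((dt T)^[2] (dx^[i] u) 0) t * deriv ((dt T)^[2] (dx^[i] g) 0) t =
      ∫ t in (0 : ℝ)..T, deriv (pd T u i 2 0) t * deriv (pd T g i 2 0) t := fun i hi =>
    int_deriv_congr pos.le (fun t ht => u.jet.pd_eq' pos hi le_rfl 0 zmem1 t ht)
      (fun t ht => g.jet.pd_eq' pos hi le_rfl 0 zmem1 t ht)
  have i0 : ∫ t in (0 : ℝ)..T, deriv (pd T u 0 2 0) t * deriv (pd T g 0 2 0) t = 0 :=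
    int_deriv_zero pos.le (u.pd_side zmem1 (fun t ht => u.bc_0t ht) le_rfl)
  have i2 : ∫ t in (0 : ℝ)..T, deriv (pd T u 2 2 0) t * deriv (pd T g 2 2 0) t =
      ∫ t in (0 : ℝ)..T, deriv (W.D u 0) t * deriv (W.D g 0) t :=
    int_deriv_congr pos.le (fun t ht => (W.D_apply u zmem1 ht).symm)
      (fun t ht => (W.D_apply g zmem1 ht).symm)
  have j0 : innerW23 (fun x => (dt T)^[0] u x 0) (fun x => (dt T)^[0] g x 0) = 0 :=
    innerW23_zero fun x hx => u.bc_x0 hx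
  have j1 : innerW23 (fun x => (dt T)^[1] u x 0) (fun x => (dt T)^[1] g x 0) = 0 :=
    innerW23_zero fun x hx => u.bc_dt hx
  have j2 : innerW23 (fun x => (dt T)^[2] u x 0) (fun x => (dt T)^[2] g x 0) =
      pd T u 0 2 0 0 * pd T g 0 2 0 0 + pd T u 1 2 0 0 * pd T g 1 2 0 0
      + pd T u 1 2 1 0 * pd T g 1 2 1 0 +
      ∫ x in (0 : ℝ)..1, deriv (fun x => pd T u 2 2 x 0) x * deriv (fun x => pd T g 2 2 x 0) x := rfl
  have j2' : ∫ x in (0 : ℝ)..1, deriv (fun x => pd T u 2 2 x 0) x * deriv (fun x => pd T g 2 2 x 0) x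
      = ∫ x in (0 : ℝ)..1, deriv (fun x => W.D u x 0) x * deriv (fun x => W.D g x 0) x :=
    int_deriv_congr zero_le_one (fun x hx => (W.D_apply u hx zmemT).symm)
      (fun x hx => (W.D_apply g hx zmemT).symm)
  have k : ∫ x in (0 : ℝ)..1, ∫ t in (0 : ℝ)..T,
      dxt T (dx^[2] ((dt T)^[2] u)) (x, t) * dxt T (dx^[2] ((dt T)^[2] g)) (x, t) =
      ∫ x in (0 : ℝ)..1, ∫ t in (0 : ℝ)..T, dxt T (W.D u) (x, t) * dxt T (W.D g) (x, t) := by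
    have e1 := (D_rep u).dxt pos.le
    have e2 := (D_rep g).dxt pos.le
    rw [dbl_full (c := fun z => dxt T (dx^[2] ((dt T)^[2] u)) z * dxt T (dx^[2] ((dt T)^[2] g)) z)
      pos.le (u.memAC2.rep.rc.1.integrable_mul g.memAC2.rep.rc.1),
      dbl_full (c := fun z => dxt T (W.D u) z * dxt T (W.D g) z)
      pos.le ((W.D u).rep.rc.1.integrable_mul (W.D g).rep.rc.1)]
    refine integral_congr_ae ?_
    filter_upwards [e1, e2] with z h1 h2
    exact congrArg₂ (· * ·) h1 h2
  have z0 : pd T u 0 2 0 0 = 0 := u.pd_side zmem1 (fun t ht => u.bc_0t ht) le_rfl 0 zmemT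
  rw [innerW, k, inner_jet0]
  simp only [Finset.sum_range_succ, Finset.sum_range_zero, j0, j1, j2, j2', hi 0 (by simp),
    hi 1 (by simp), hi 2 le_rfl, i0, i2, z0]
  ring

theorem p_rep (u : W T) : Rep T (pd T u 1 2 0) (deriv (pd T u 1 2 0)) := by
  obtain ⟨q, hq⟩ := rep_trace (memAC2_Vx pos.le (memAC2_Vx pos.le u.memAC2))
  have h := (hq.smul (-1)).congr (f' := pd T u 1 2 0) fun t ht => by
    rw [u.s_p ht]; ring
  exact (h.memW21 pos.le).1.rep

/-- Auxiliary: `∂⁴u/∂t³∂x(0,·)` as an element of `L²[0,T]`. -/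
def pLp : W T →ₗ[ℝ] L2 T where
  toFun u := (p_rep u).1.toLp _
  map_add' u v := by
    have h : Rep T (pd T (u + v : W T) 1 2 0) _ := ((p_rep u).add (p_rep v)).congr fun t ht =>
      W.pd_add u v (by simp) le_rfl zmem1 ht
    rw [← MemLp.toLp_add]
    exact MemLp.toLp_congr _ h.1 (h.memW21 pos.le).2
  map_smul' r u := by
    have h : Rep T (pd T (r • u : W T) 1 2 0) _ := ((p_rep u).smul r).congr fun t ht =>
      W.pd_smul r u (by simp) le_rfl zmem1 ht
    rw [RingHom.id_apply, ← MemLp.toLp_const_smul]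
    exact MemLp.toLp_congr _ h.1 (h.memW21 pos.le).2

/-- Auxiliary: `∂³u/∂t²∂x(x,0)`. -/
def evd (x : ℝ) (hx : x ∈ Icc (0 : ℝ) 1) : W T →ₗ[ℝ] ℝ where
  toFun u := pd T u 1 2 x 0
  map_add' u v := W.pd_add u v (by simp) le_rfl hx zmemT
  map_smul' r u := W.pd_smul r u (by simp) le_rfl hx zmemT

abbrev EW (T : ℝ) : Type := WithLp 2 (L2 T × WithLp 2 (ℝ × WithLp 2 (ℝ × E0 T)))

/-- Auxiliary: all the derivatives that occur in the norm of `W(Ω)`. -/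
def jetW : W T →ₗ[ℝ] EW T :=
  (WithLp.linearEquiv 2 ℝ _).symm.toLinearMap ∘ₗ pLp.prod
    ((WithLp.linearEquiv 2 ℝ _).symm.toLinearMap ∘ₗ (evd 0 zmem1).prod
      ((WithLp.linearEquiv 2 ℝ _).symm.toLinearMap ∘ₗ (evd 1 omem1).prod (jet0 ∘ₗ W.D)))

theorem jetW_apply (u : W T) : jetW u = WithLp.toLp 2 (pLp u, WithLp.toLp 2 (pd T u 1 2 0 0,
    WithLp.toLp 2 (pd T u 1 2 1 0, jet0 (W.D u)))) := rfl

theorem innerW_eq (u g : W T) : innerW T u g = inner ℝ (jetW u) (jetW g) := by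
  rw [innerW_eq0, jetW_apply, jetW_apply]
  simp only [WithLp.prod_inner_apply]
  have : inner ℝ (pLp u) (pLp g) = _ := inner_toLp_int pos.le (p_rep u).1 (p_rep g).1
  rw [this]
  simp [mul_comm]

theorem s12_10 (u : W T) : pd T u 1 2 1 0 = pd T u 1 2 0 0 + W.D u 0 0 +
    ∫ x in (0 : ℝ)..1, (W.D u x 0 - W.D u 0 0) := by
  have hc : ContinuousOn (fun x => W.D u x 0) (Icc 0 1) := (W.D u).rep.slice_t pos.le zmemT
  rw [intervalIntegral.integral_sub (intInt (memLp_cont hc) omem1) intervalIntegrable_const,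
    u.s12 omem1 zmemT]
  have : ∫ x in (0 : ℝ)..1, W.D u x 0 = ∫ x in (0 : ℝ)..1, pd T u 2 2 x 0 := by
    refine intervalIntegral.integral_congr fun y hy => ?_
    rw [uIcc_of_le zero_le_one] at hy
    exact W.D_apply u hy zmemT
  rw [this]
  simp

theorem jetW_inj (u : W T) (h : jetW u = 0) : u = 0 := by
  have h0 : pd T u 1 2 0 0 = 0 := congrArg (fun e : EW T => e.ofLp.2.ofLp.1) h
  have h1 : pd T u 1 2 1 0 = 0 := congrArg (fun e : EW T => e.ofLp.2.ofLp.2.ofLp.1) h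
  have h2 : jet0 (W.D u) = 0 := congrArg (fun e : EW T => e.ofLp.2.ofLp.2.ofLp.2) h
  have h3 := s12_10 u
  have h4 : ∫ x in (0 : ℝ)..1, (W.D u x 0 - W.D u 0 0) = 0 := by
    rw [intervalIntegral.integral_congr (g := fun _ => 0), intervalIntegral.integral_zero]
    intro y hy
    rw [uIcc_of_le zero_le_one] at hy
    exact sub_eq_zero.2 (jet0_zero h2 hy zmemT)
  rw [h0, h1, h4] at h3
  refine u.eq_zero fun x hx t ht => ?_
  rw [← W.D_apply u hx ht, jet0_zero h2 hx ht]
  linarith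

@[reducible] def coreW : InnerProductSpace.Core ℝ (W T) :=
  coreOf (fun f g => innerW T f g) jetW jetW_inj innerW_eq

instance : NormedAddCommGroup (W T) := (coreW (T := T)).toNormedAddCommGroup
instance : InnerProductSpace ℝ (W T) := InnerProductSpace.ofCore (coreW (T := T)).toCore

theorem W.inner_eq (f g : W T) : inner ℝ f g = innerW T f g := rfl

theorem norm_jetW (f : W T) : ‖jetW f‖ = ‖f‖ := by
  rw [@norm_eq_sqrt_real_inner _ _ _ f, @norm_eq_sqrt_real_inner _ _ _ (jetW f),
    W.inner_eq, innerW_eq]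

theorem prod_norm_le {E F : Type*} [NormedAddCommGroup E] [NormedAddCommGroup F]
    (x : WithLp 2 (E × F)) : ‖x‖ ≤ ‖x.ofLp.1‖ + ‖x.ofLp.2‖ := by
  rw [WithLp.prod_norm_eq_of_L2]
  refine Real.sqrt_le_iff.2 ⟨by positivity, ?_⟩
  have h1 := mul_nonneg (norm_nonneg x.ofLp.1) (norm_nonneg x.ofLp.2)
  change ‖x.ofLp.1‖ ^ 2 + ‖x.ofLp.2‖ ^ 2 ≤ _
  nlinarith

theorem D_bound : ∃ C : ℝ, ∀ u : W T, ‖W.D u‖ ≤ C * ‖u‖ := by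
  refine ⟨3 + (volume.restrict (Icc (0 : ℝ) 1)).real univ ^ (1 / 2 : ℝ), fun u => ?_⟩
  set K := (volume.restrict (Icc (0 : ℝ) 1)).real univ ^ (1 / 2 : ℝ) with hK
  have hK0 : 0 ≤ K := by positivity
  have e1 : ‖(jetW u).ofLp.2‖ ≤ ‖u‖ := norm_jetW u ▸ norm_snd_le (jetW u)
  have e2 : ‖(jetW u).ofLp.2.ofLp.2‖ ≤ ‖u‖ := (norm_snd_le (jetW u).ofLp.2).trans e1
  have n0 : |pd T u 1 2 0 0| ≤ ‖u‖ := (norm_fst_le (jetW u).ofLp.2).trans e1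
  have n1 : |pd T u 1 2 1 0| ≤ ‖u‖ := (norm_fst_le (jetW u).ofLp.2.ofLp.2).trans e2
  have nj : ‖jet0 (W.D u)‖ ≤ ‖u‖ := (norm_snd_le (jetW u).ofLp.2.ofLp.2).trans e2
  have na : ‖(W.D u).rep.ra.1.toLp _‖ ≤ ‖u‖ := (norm_fst_le (jet0 (W.D u))).trans nj
  have n3 : |∫ x in (0 : ℝ)..1, (W.D u x 0 - W.D u 0 0)| ≤ K * ‖u‖ := by
    have := intervalIntegral.norm_integral_le_of_norm_le_const (a := 0) (b := 1)
      (f := fun x => W.D u x 0 - W.D u 0 0) (C := K * ‖u‖) (fun x hx => by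
        rw [uIoc_of_le zero_le_one] at hx
        have hx' := Ioc_subset_Icc_self hx
        have h1 := (W.D u).rep.ra.2 x hx'
        have h2 := (abs_int_le (W.D u).rep.ra.1 hx').trans (mul_le_mul_of_nonneg_left na hK0)
        rw [Real.norm_eq_abs]
        refine le_trans (le_of_eq ?_) h2
        congr 1
        exact sub_eq_iff_eq_add'.2 h1)
    simpa using this
  have h3 := s12_10 u
  have n4 : |W.D u 0 0| ≤ (2 + K) * ‖u‖ := by
    rw [abs_le] at *
    constructor <;> nlinarith
  rw [← norm_jetHat]
  refine (prod_norm_le _).trans ?_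
  have : ‖(jetHat (W.D u)).ofLp.1‖ = |W.D u 0 0| := rfl
  have h5 : (jetHat (W.D u)).ofLp.2 = jet0 (W.D u) := rfl
  rw [this, h5]
  linarith

end

section

variable {T : ℝ}

/-- Auxiliary: joint continuity. -/
def Cont2 (f : ℝ → ℝ → ℝ) : Prop := Continuous (fun p : ℝ × ℝ => f p.1 p.2)
/-- Auxiliary: primitive in `t`. -/
def Vt (f : ℝ → ℝ → ℝ) : ℝ → ℝ → ℝ := fun x t => ∫ s in (0 : ℝ)..t, f x s
/-- Auxiliary: primitive in `x`. -/
def Vx (f : ℝ → ℝ → ℝ) : ℝ → ℝ → ℝ := fun x t => ∫ y in (0 : ℝ)..x, f y t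

theorem Cont2.t {f : ℝ → ℝ → ℝ} (h : Cont2 f) (x : ℝ) : Continuous (f x) :=
  Continuous.comp (g := fun p : ℝ × ℝ => f p.1 p.2) h (Continuous.prodMk_right x)
theorem Cont2.x {f : ℝ → ℝ → ℝ} (h : Cont2 f) (t : ℝ) : Continuous (fun x => f x t) :=
  Continuous.comp (g := fun p : ℝ × ℝ => f p.1 p.2) h (Continuous.prodMk_left t)

theorem Cont2.Vt {f : ℝ → ℝ → ℝ} (h : Cont2 f) : Cont2 (Vt f) :=
  intervalIntegral.continuous_parametric_intervalIntegral_of_continuous (μ := volume)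
    (f := fun (p : ℝ × ℝ) s => f p.1 s)
    (Continuous.comp (g := fun p : ℝ × ℝ => f p.1 p.2)
      (f := fun q : (ℝ × ℝ) × ℝ => (q.1.1, q.2)) h (by fun_prop)) continuous_snd

theorem Cont2.Vx {f : ℝ → ℝ → ℝ} (h : Cont2 f) : Cont2 (Vx f) :=
  intervalIntegral.continuous_parametric_intervalIntegral_of_continuous (μ := volume)
    (f := fun (p : ℝ × ℝ) s => f s p.2)
    (Continuous.comp (g := fun p : ℝ × ℝ => f p.1 p.2)
      (f := fun q : (ℝ × ℝ) × ℝ => (q.2, q.1.2)) h (by fun_prop)) continuous_fst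

theorem Cont2.Vt_deriv {f : ℝ → ℝ → ℝ} (h : Cont2 f) (x t : ℝ) :
    HasDerivAt (SGK.Vt f x) (f x t) t :=
  intervalIntegral.integral_hasDerivAt_right ((h.t x).intervalIntegrable _ _)
    ((h.t x).stronglyMeasurableAtFilter _ _) (h.t x).continuousAt

theorem Cont2.Vx_deriv {f : ℝ → ℝ → ℝ} (h : Cont2 f) (x t : ℝ) :
    HasDerivAt (fun y => SGK.Vx f y t) (f x t) x :=
  intervalIntegral.integral_hasDerivAt_right ((h.x t).intervalIntegrable _ _)
    ((h.x t).stronglyMeasurableAtFilter _ _) (h.x t).continuousAt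

/-- Auxiliary: `f` is a primitive of `g` in `x`. -/
def Prim (T : ℝ) (f g : ℝ → ℝ → ℝ) : Prop :=
  ∀ x ∈ Icc (0 : ℝ) 1, ∀ t ∈ Icc 0 T, f x t = f 0 t + ∫ y in (0 : ℝ)..x, g y t

theorem Prim.deriv {f g : ℝ → ℝ → ℝ} (h : Prim T f g) (hg : Cont2 g) {x t : ℝ}
    (hx : x ∈ Icc (0 : ℝ) 1) (ht : t ∈ Icc 0 T) :
    HasDerivWithinAt (fun y => f y t) (g x t) (Icc 0 1) x :=
  ((hg.Vx_deriv x t).const_add (f 0 t)).hasDerivWithinAt.congr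
    (fun y hy => h y hy t ht) (h x hx t ht)

theorem Prim.Vt {f g : ℝ → ℝ → ℝ} (h : Prim T f g) (hf : Cont2 f) (hg : Cont2 g) :
    Prim T (Vt f) (Vt g) := by
  intro x hx t ht
  have hi : IntegrableOn (fun z : ℝ × ℝ => g z.1 z.2) (Omega T) :=
    Continuous.continuousOn hg |>.integrableOn_compact (isCompact_Icc.prod isCompact_Icc)
  have h1 := swap_int hi hx ht
  have h2 : ∫ s in (0 : ℝ)..t, f x s = ∫ s in (0 : ℝ)..t, (f 0 s + ∫ y in (0 : ℝ)..x, g y s) := by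
    refine intervalIntegral.integral_congr fun s hs => ?_
    rw [uIcc_of_le ht.1] at hs
    exact h x hx s ⟨hs.1, hs.2.trans ht.2⟩
  have h3 : Continuous (fun s => ∫ y in (0 : ℝ)..x, g y s) := hg.Vx.t x
  simp only [SGK.Vt]
  rw [h2, intervalIntegral.integral_add ((hf.t 0).intervalIntegrable _ _)
    (h3.intervalIntegrable _ _), h1]

theorem dt_off {u : ℝ → ℝ → ℝ} (h : ∀ x t, (x, t) ∉ Omega T → u x t = 0) :
    ∀ x t, (x, t) ∉ Omega T → dt T u x t = 0 := by
  intro x t hxt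
  by_cases hx : x ∈ Icc (0 : ℝ) 1
  · refine derivWithin_zero_of_notMem_closure ?_
    rw [isClosed_Icc.closure_eq]
    exact fun ht => hxt ⟨hx, ht⟩
  · have : u x = fun _ => 0 := funext fun s => h x s fun h' => hx h'.1
    simp [dt, this]

theorem dx_off {u : ℝ → ℝ → ℝ} (h : ∀ x t, (x, t) ∉ Omega T → u x t = 0) :
    ∀ x t, (x, t) ∉ Omega T → dx u x t = 0 := by
  intro x t hxt
  by_cases ht : t ∈ Icc 0 T
  · refine derivWithin_zero_of_notMem_closure ?_
    rw [isClosed_Icc.closure_eq]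
    exact fun hx => hxt ⟨hx, ht⟩
  · have : (fun y => u y t) = fun _ => 0 := funext fun s => h s t fun h' => ht h'.2
    simp [dx, this]

variable [Fact (0 < T)]

theorem D_surj (w : WHat T) : ∃ u : W T, W.D u = w := by
  classical
  have hT : 0 ≤ T := pos.le
  set wc : ℝ → ℝ → ℝ := fun x t => w (projIcc 0 1 zero_le_one x) (projIcc 0 T hT t) with hwc
  have hc : Cont2 wc := by
    have h1 := w.rep.continuousOn hT
    refine h1.comp_continuous (f := fun p : ℝ × ℝ =>
      ((projIcc 0 1 zero_le_one p.1 : ℝ), (projIcc 0 T hT p.2 : ℝ))) ?_ fun p => ⟨?_, ?_⟩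
    · exact (continuous_subtype_val.comp (continuous_projIcc.comp continuous_fst)).prodMk
        (continuous_subtype_val.comp (continuous_projIcc.comp continuous_snd))
    · exact Subtype.coe_prop _
    · exact Subtype.coe_prop _
  have hw : ∀ x ∈ Icc (0 : ℝ) 1, ∀ t ∈ Icc 0 T, wc x t = w x t := fun x hx t ht => by
    simp only [hwc]
    rw [projIcc_of_mem _ hx, projIcc_of_mem _ ht]
  set p : ℝ → ℝ := fun t => - Vx (Vx wc) 1 t with hp
  have hpc : Continuous p := (hc.Vx.Vx.t 1).neg
  set A0 : ℝ → ℝ → ℝ := fun x t => Vx (Vx wc) x t + x * p t with hA0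
  set A1 : ℝ → ℝ → ℝ := fun x t => Vx wc x t + p t with hA1
  have c0 : Cont2 A0 := Continuous.add hc.Vx.Vx (by fun_prop)
  have c1 : Cont2 A1 := Continuous.add hc.Vx (by fun_prop)
  have p1 : Prim T A1 wc := fun x hx t ht => by simp [hA1, Vx, add_comm]
  have p0 : Prim T A0 A1 := fun x hx t ht => by
    simp only [hA0, hA1]
    rw [intervalIntegral.integral_add ((hc.Vx.x t).intervalIntegrable _ _)
      intervalIntegrable_const]
    simp [Vx]
  let A : ℕ → ℝ → ℝ → ℝ := fun i => if i = 0 then A0 else if i = 1 then A1 else wc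
  let U : ℕ → ℕ → ℝ → ℝ → ℝ := fun i j => Vt^[2 - j] (A i)
  have cA : ∀ i, Cont2 (A i) := fun i => by
    simp only [A]; split_ifs <;> assumption
  have cU : ∀ i j, Cont2 (U i j) := fun i j => by
    simp only [U]
    induction (2 - j) with
    | zero => exact cA i
    | succ n ih => rw [Function.iterate_succ_apply']; exact ih.Vt
  have pA : ∀ i < 2, Prim T (A i) (A (i + 1)) := fun i hi => by
    interval_cases i
    · exact p0
    · exact p1
  have pU : ∀ i < 2, ∀ j, Prim T (U i j) (U (i + 1) j) := fun i hi j => by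
    have : ∀ n, Prim T (Vt^[n] (A i)) (Vt^[n] (A (i + 1))) ∧ Cont2 (Vt^[n] (A i)) ∧
        Cont2 (Vt^[n] (A (i + 1))) := fun n => by
      induction n with
      | zero => exact ⟨pA i hi, cA i, cA (i + 1)⟩
      | succ n ih =>
        simp only [Function.iterate_succ_apply']
        exact ⟨ih.1.Vt ih.2.1 ih.2.2, ih.2.1.Vt, ih.2.2.Vt⟩
    exact (this _).1
  have hU : ∀ i, ∀ j < 2, U i j = Vt (U i (j + 1)) := fun i j hj => by
    simp only [U]
    rw [← Function.iterate_succ_apply' Vt]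
    congr 1; omega
  set u : ℝ → ℝ → ℝ := fun x t => if (x, t) ∈ Omega T then U 0 0 x t else 0 with hu
  have hu0 : ∀ x ∈ Icc (0 : ℝ) 1, ∀ t ∈ Icc 0 T, u x t = U 0 0 x t := fun x hx t ht =>
    if_pos (show (x, t) ∈ Omega T from ⟨hx, ht⟩)
  have hJ : IsJet T u U := by
    refine ⟨fun x hx t ht => (hu0 x hx t ht).symm,
      fun i hi j _ x hx t ht => (pU i hi j).deriv (cU _ _) hx ht, fun i _ j hj x hx t ht => ?_⟩
    rw [hU i j hj]
    exact ((cU i (j + 1)).Vt_deriv x t).hasDerivWithinAt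
  have side : ∀ a t, (∀ t, A0 a t = 0) → U 0 0 a t = 0 := fun a t h => by
    have e : U 0 0 a t = Vt (Vt A0) a t := rfl
    rw [e]
    simp [Vt, h]
  have hmem : MemW T u := by
    refine ⟨fun x t h => if_neg h, ⟨U, hJ⟩, ?_, fun x hx => ?_, fun x hx => ?_,
      fun t ht => ?_, fun t ht => ?_⟩
    · refine MemAC2.congr hT w.2.2 fun x hx t ht => ?_
      exact (hJ.pd_eq pos le_rfl le_rfl x hx t ht).trans (hw x hx t ht)
    · rw [hu0 x hx 0 zmemT, hU 0 0 (by simp)]; simp [Vt]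
    · refine (hJ.pd_eq pos (i := 0) (j := 1) (by simp) (by simp) x hx 0 zmemT).trans ?_
      rw [hU 0 1 (by simp)]; simp [Vt]
    · rw [hu0 0 zmem1 t ht]
      exact side 0 t fun s => by simp [hA0, Vx]
    · rw [hu0 1 omem1 t ht]
      exact side 1 t fun s => by simp [hA0, hp]
  refine ⟨⟨u, hmem⟩, WHat.ext fun x hx t ht => ?_⟩
  refine (W.D_apply _ hx ht).trans ?_
  exact (hJ.pd_eq pos le_rfl le_rfl x hx t ht).trans (hw x hx t ht)

/-! bounds -/

theorem int_bound {x C : ℝ} {f : ℝ → ℝ} (hx : 0 ≤ x)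
    (h : ∀ y ∈ Icc 0 x, |f y| ≤ C) : |∫ y in (0 : ℝ)..x, f y| ≤ C * x := by
  have := intervalIntegral.norm_integral_le_of_norm_le_const (a := 0) (b := x)
      (f := f) (C := C) (fun y hy => by
        rw [uIoc_of_le hx] at hy
        exact h y (Ioc_subset_Icc_self hy))
  simpa [abs_of_nonneg hx] using this

theorem bounds {u : W T} {C : ℝ} (hC : 0 ≤ C)
    (h : ∀ x ∈ Icc (0 : ℝ) 1, ∀ t ∈ Icc 0 T, |pd T u 2 2 x t| ≤ C)
    {x t : ℝ} (hx : x ∈ Icc (0 : ℝ) 1) (ht : t ∈ Icc 0 T) :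
    |pd T u 1 2 x t| ≤ 2 * C ∧ |pd T u 0 2 x t| ≤ 2 * C ∧ |pd T u 2 0 x t| ≤ C * T * T := by
  have i1 : ∀ y ∈ Icc (0 : ℝ) 1, |∫ z in (0 : ℝ)..y, pd T u 2 2 z t| ≤ C := fun y hy =>
    (int_bound hy.1 fun z hz => h z ⟨hz.1, hz.2.trans hy.2⟩ t ht).trans
      (mul_le_of_le_one_right hC hy.2)
  have i2 : ∀ y ∈ Icc (0 : ℝ) 1,
      |∫ y in (0 : ℝ)..y, ∫ z in (0 : ℝ)..y, pd T u 2 2 z t| ≤ C := fun y hy =>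
    (int_bound hy.1 fun z hz => i1 z ⟨hz.1, hz.2.trans hy.2⟩).trans
      (mul_le_of_le_one_right hC hy.2)
  have hp : |pd T u 1 2 0 t| ≤ C := by rw [u.s_p ht, abs_neg]; exact i2 1 omem1
  refine ⟨?_, ?_, ?_⟩
  · rw [u.s12 hx ht]
    refine (abs_add_le _ _).trans ?_
    linarith [i1 x hx]
  · rw [u.s02 hx ht]
    refine (abs_add_le _ _).trans ?_
    rw [abs_mul, abs_of_nonneg hx.1]
    have : x * |pd T u 1 2 0 t| ≤ 1 * C := mul_le_mul hx.2 hp (abs_nonneg _) zero_le_one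
    linarith [i2 x hx]
  · rw [u.s20 hx ht]
    have hT : 0 ≤ T := pos.le
    refine (int_bound (C := C * T) ht.1 fun s hs => ?_).trans
      (mul_le_mul_of_nonneg_left ht.2 (by positivity))
    exact (int_bound hs.1 fun r hr => h x hx r ⟨hr.1, hr.2.trans (hs.2.trans ht.2)⟩).trans
      (mul_le_mul_of_nonneg_left (hs.2.trans ht.2) hC)

theorem pd_bound : ∃ C : ℝ, ∀ u : W T, ∀ x ∈ Icc (0 : ℝ) 1, ∀ t ∈ Icc 0 T,
    |pd T u 1 2 x t| ≤ C * ‖W.D u‖ ∧ |pd T u 0 2 x t| ≤ C * ‖W.D u‖ ∧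
      |pd T u 2 0 x t| ≤ C * ‖W.D u‖ := by
  obtain ⟨C, hC, hb⟩ := WHat.bound (T := T)
  have hT : 0 ≤ T := pos.le
  refine ⟨C * (2 + T * T), fun u x hx t ht => ?_⟩
  have hN := mul_nonneg hC (norm_nonneg (W.D u))
  have := bounds (u := u) hN (fun x hx t ht => by
    rw [← W.D_apply u hx ht]; exact hb _ x hx t ht) hx ht
  have h2 : 0 ≤ C * ‖W.D u‖ * T * T := by positivity
  refine ⟨this.1.trans ?_, this.2.1.trans ?_, this.2.2.trans ?_⟩ <;> nlinarith

theorem pd_sub (u v : W T) {i j : ℕ} (hi : i ≤ 2) (hj : j ≤ 2) {x t : ℝ}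
    (hx : x ∈ Icc (0 : ℝ) 1) (ht : t ∈ Icc 0 T) :
    pd T (u - v : W T) i j x t = pd T u i j x t - pd T v i j x t := by
  have h := W.pd_add (u - v) v hi hj hx ht
  rw [sub_add_cancel] at h
  linarith

theorem tendsto_of_bound {α : ℕ → ℝ} {a C : ℝ} {β : ℕ → ℝ} (h : ∀ n, |α n - a| ≤ C * β n)
    (hβ : Tendsto β atTop (𝓝 0)) : Tendsto α atTop (𝓝 a) := by
  rw [tendsto_iff_norm_sub_tendsto_zero]
  refine squeeze_zero (fun _ => norm_nonneg _) h ?_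
  simpa using hβ.const_mul C

instance : CompleteSpace (W T) := by
  refine Metric.complete_of_cauchySeq_tendsto fun u hu => ?_
  obtain ⟨C, hC⟩ := D_bound (T := T)
  let jW : W T →ₗᵢ[ℝ] EW T := ⟨jetW, norm_jetW⟩
  let DL : W T →L[ℝ] WHat T := LinearMap.mkContinuous W.D C hC
  obtain ⟨e, he⟩ := cauchySeq_tendsto_of_complete
    (jW.isometry.uniformContinuous.comp_cauchySeq hu)
  obtain ⟨w, hw⟩ := cauchySeq_tendsto_of_complete (DL.uniformContinuous.comp_cauchySeq hu)
  have hw : Tendsto (fun n => W.D (u n)) atTop (𝓝 w) := hw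
  have he : Tendsto (fun n => jetW (u n)) atTop (𝓝 e) := he
  obtain ⟨v, rfl⟩ := D_surj w
  obtain ⟨B, hB⟩ := pd_bound (T := T)
  have hD : Tendsto (fun n => ‖W.D (u n - v)‖) atTop (𝓝 0) := by
    simp only [map_sub]; exact tendsto_iff_norm_sub_tendsto_zero.1 hw
  have hpd : ∀ x ∈ Icc (0 : ℝ) 1, ∀ t ∈ Icc 0 T,
      Tendsto (fun n => pd T (u n) 1 2 x t) atTop (𝓝 (pd T v 1 2 x t)) := fun x hx t ht => by
    refine tendsto_of_bound (C := B) (fun n => ?_) hD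
    rw [← pd_sub _ _ (by simp) le_rfl hx ht]
    exact (hB _ x hx t ht).1
  -- the components of the limit
  have cf : Continuous (fun e : EW T => e.ofLp) := WithLp.prod_continuous_ofLp 2 _ _
  have t1 : Tendsto (fun n => pLp (u n)) atTop (𝓝 e.ofLp.1) :=
    ((continuous_fst.comp (WithLp.prod_continuous_ofLp 2 _ _)).tendsto e).comp he
  have t2 : Tendsto (fun n => (jetW (u n)).ofLp.2) atTop (𝓝 e.ofLp.2) :=
    ((continuous_snd.comp (WithLp.prod_continuous_ofLp 2 _ _)).tendsto e).comp he
  have t3 : Tendsto (fun n => pd T (u n) 1 2 0 0) atTop (𝓝 e.ofLp.2.ofLp.1) :=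
    ((continuous_fst.comp (WithLp.prod_continuous_ofLp 2 _ _)).tendsto _).comp t2
  have t4 : Tendsto (fun n => (jetW (u n)).ofLp.2.ofLp.2) atTop (𝓝 e.ofLp.2.ofLp.2) :=
    ((continuous_snd.comp (WithLp.prod_continuous_ofLp 2 _ _)).tendsto _).comp t2
  have t5 : Tendsto (fun n => pd T (u n) 1 2 1 0) atTop (𝓝 e.ofLp.2.ofLp.2.ofLp.1) :=
    ((continuous_fst.comp (WithLp.prod_continuous_ofLp 2 _ _)).tendsto _).comp t4
  have t6 : Tendsto (fun n => jet0 (W.D (u n))) atTop (𝓝 e.ofLp.2.ofLp.2.ofLp.2) :=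
    ((continuous_snd.comp (WithLp.prod_continuous_ofLp 2 _ _)).tendsto _).comp t4
  have e3 : e.ofLp.2.ofLp.1 = pd T v 1 2 0 0 := tendsto_nhds_unique t3 (hpd 0 zmem1 0 zmemT)
  have e5 : e.ofLp.2.ofLp.2.ofLp.1 = pd T v 1 2 1 0 :=
    tendsto_nhds_unique t5 (hpd 1 omem1 0 zmemT)
  have e6 : e.ofLp.2.ofLp.2.ofLp.2 = jet0 (W.D v) := by
    refine tendsto_nhds_unique t6 (tendsto_iff_norm_sub_tendsto_zero.2 ?_)
    refine squeeze_zero (fun _ => norm_nonneg _) (fun n => ?_)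
      (tendsto_iff_norm_sub_tendsto_zero.1 hw)
    rw [← map_sub, ← norm_jetHat]
    exact norm_snd_le (jetHat (W.D (u n) - W.D v))
  have e1 : e.ofLp.1 = pLp v := by
    set q := e.ofLp.1
    have hrep : Rep T (pd T v 1 2 0) q := by
      refine ⟨Lp.memLp q, fun t ht => ?_⟩
      have l1 := hpd 0 zmem1 t ht
      have l2 : Tendsto (fun n => ∫ s in (0 : ℝ)..t, deriv (pd T (u n) 1 2 0) s) atTop
          (𝓝 (∫ s in (0 : ℝ)..t, q s)) := by
        refine tendsto_of_bound
          (C := ((volume.restrict (Icc 0 T)).real univ) ^ (1 / 2 : ℝ)) (fun n => ?_)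
          (tendsto_iff_norm_sub_tendsto_zero.1 t1)
        rw [← intervalIntegral.integral_sub (intInt (p_rep (u n)).1 ht) (intInt (Lp.memLp q) ht)]
        refine (abs_int_le ((p_rep (u n)).1.sub (Lp.memLp q)) ht).trans (le_of_eq ?_)
        rw [MemLp.toLp_sub (p_rep (u n)).1 (Lp.memLp q), Lp.toLp_coeFn]
        rfl
      have l3 := (hpd 0 zmem1 0 zmemT).add l2
      refine tendsto_nhds_unique l1 (l3.congr fun n => ?_)
      exact ((p_rep (u n)).2 t ht).symm
    have := MemLp.toLp_congr (p_rep v).1 (Lp.memLp q) (hrep.memW21 pos.le).2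
    rw [Lp.toLp_coeFn] at this
    exact this.symm
  have hE : e = jetW v := by
    rw [jetW_apply]
    refine WithLp.ofLp_injective 2 (Prod.ext e1 (WithLp.ofLp_injective 2 (Prod.ext e3
      (WithLp.ofLp_injective 2 (Prod.ext e5 e6)))))
  refine ⟨v, tendsto_iff_norm_sub_tendsto_zero.2 ?_⟩
  have := tendsto_iff_norm_sub_tendsto_zero.1 he
  rw [hE] at this
  simpa only [← map_sub, norm_jetW] using this

/-! the operator -/

theorem L_mem (u : W T) :
    (fun x t => (dt T)^[2] u x t - dx^[2] u x t) ∈ WHatSub T := by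
  refine ⟨fun x t h => ?_, ?_⟩
  · have h1 : (dt T)^[2] u x t = 0 := dt_off (dt_off u.2.1) x t h
    have h2 : dx^[2] u x t = 0 := dx_off (dx_off u.2.1) x t h
    beta_reduce
    rw [h1, h2, sub_zero]
  · have m1 := memAC2_xp pos.le (p_rep u)
    have m2 := memAC2_Vx pos.le (memAC2_Vx pos.le u.memAC2)
    have m3 := memAC2_Vt pos.le (memAC2_Vt pos.le u.memAC2)
    refine ((m1.add pos.le m2).add pos.le (m3.smul pos.le (-1))).congr pos.le fun x hx t ht => ?_
    have h1 : (dt T)^[2] u x t = _ := u.s02 hx ht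
    have h2 : dx^[2] u x t = _ := u.s20 hx ht
    rw [h1, h2]; ring

/-- The linear operator `L u = ∂²u/∂t² - ∂²u/∂x²` from `W(Ω)` to `Ŵ(Ω)`. -/
def Llin : W T →ₗ[ℝ] WHat T where
  toFun u := ⟨fun x t => (dt T)^[2] u x t - dx^[2] u x t, L_mem u⟩
  map_add' u v := WHat.ext fun x hx t ht => by
    have h1 := W.pd_add u v (i := 0) (j := 2) (by simp) le_rfl hx ht
    have h2 := W.pd_add u v (i := 2) (j := 0) le_rfl (by simp) hx ht
    change pd T (u + v : W T) 0 2 x t - pd T (u + v : W T) 2 0 x t =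
      (pd T u 0 2 x t - pd T u 2 0 x t) + (pd T v 0 2 x t - pd T v 2 0 x t)
    rw [h1, h2]; ring
  map_smul' r u := WHat.ext fun x hx t ht => by
    have h1 := W.pd_smul r u (i := 0) (j := 2) (by simp) le_rfl hx ht
    have h2 := W.pd_smul r u (i := 2) (j := 0) le_rfl (by simp) hx ht
    change pd T (r • u : W T) 0 2 x t - pd T (r • u : W T) 2 0 x t =
      r * (pd T u 0 2 x t - pd T u 2 0 x t)
    rw [h1, h2]; ring

theorem L_cont : Continuous (Llin (T := T)) := by
  refine LinearMap.continuous_of_seq_closed_graph _ fun u v f hu hf => ?_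
  obtain ⟨C, hC⟩ := D_bound (T := T)
  obtain ⟨B, hB⟩ := pd_bound (T := T)
  obtain ⟨A, _, hA⟩ := WHat.bound (T := T)
  have hD : Tendsto (fun n => ‖W.D (u n - v)‖) atTop (𝓝 0) :=
    squeeze_zero (fun _ => norm_nonneg _) (fun n => hC _)
      (by simpa using (tendsto_iff_norm_sub_tendsto_zero.1 hu).const_mul C)
  refine WHat.ext fun x hx t ht => ?_
  have l1 : Tendsto (fun n => Llin (u n) x t) atTop (𝓝 (f x t)) := by
    refine tendsto_of_bound (C := A) (fun n => ?_) (tendsto_iff_norm_sub_tendsto_zero.1 hf)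
    exact hA (Llin (u n) - f) x hx t ht
  have l2 : Tendsto (fun n => pd T (u n) 0 2 x t) atTop (𝓝 (pd T v 0 2 x t)) := by
    refine tendsto_of_bound (C := B) (fun n => ?_) hD
    rw [← pd_sub _ _ (by simp) le_rfl hx ht]
    exact (hB _ x hx t ht).2.1
  have l3 : Tendsto (fun n => pd T (u n) 2 0 x t) atTop (𝓝 (pd T v 2 0 x t)) := by
    refine tendsto_of_bound (C := B) (fun n => ?_) hD
    rw [← pd_sub _ _ le_rfl (by simp) hx ht]
    exact (hB _ x hx t ht).2.2
  exact tendsto_nhds_unique l1 (l2.sub l3)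

/-- The bounded linear operator `L u = ∂²u/∂t² - ∂²u/∂x²` from `W(Ω)` to `Ŵ(Ω)`. -/
def L : W T →L[ℝ] WHat T := ⟨Llin, L_cont⟩

/-! kernel -/

/-- The reproducing kernel `Q_y(x)` of `W_2^1[0,1]`, given by the same formula as the kernel `q_s(t)`
of `W_2^1[0,T]`. -/
def kerOne (y x : ℝ) : ℝ := if x ≤ y then 1 + x else 1 + y

theorem kerOne_memW21 (S y : ℝ) : MemW21 S (kerOne y) := by
  have h : kerOne y = fun x => 1 + min x y := by
    funext x
    by_cases hx : x ≤ y
    · simp [kerOne, hx]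
    · simp [kerOne, hx, (not_le.1 hx).le]
  have hl : LipschitzWith 1 (kerOne y) := by
    rw [h]
    refine LipschitzWith.of_dist_le_mul fun a b => ?_
    simpa [Real.dist_eq] using abs_min_sub_min_le_max a y b y
  refine ⟨hl.lipschitzOnWith.absolutelyContinuousOnInterval, ?_⟩
  refine MemLp.of_bound (measurable_deriv _).aestronglyMeasurable 1
    (Eventually.of_forall fun x => ?_)
  simpa using norm_deriv_le_of_lipschitz hl (x₀ := x)

theorem memAC2_mul {k l : ℝ → ℝ} (hk : MemW21 1 k) (hl : MemW21 T l) :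
    MemAC2 T (fun x t => k x * l t) := by
  have hT : 0 ≤ T := pos.le
  have hm : MemLp (fun z : ℝ × ℝ => deriv k z.1 * deriv l z.2) 2 (volume.restrict (Omega T)) := by
    rw [restrict_Omega]
    have h1 := (hk.2.comp_fst (res T)).1.mul (hl.2.comp_snd (res 1)).1
    refine (memLp_two_iff_integrable_sq h1).2 ?_
    simp only [Pi.mul_apply, mul_pow]
    exact hk.2.integrable_sq.mul_prod hl.2.integrable_sq
  refine Rep2.memAC2 hT (a := fun x => l 0 * deriv k x) (b := fun t => k 0 * deriv l t)
    ⟨(hk.rep.smul (l 0)).congr fun x _ => mul_comm _ _, hl.rep.smul (k 0), hm,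
      fun x hx t ht => ?_⟩
  simp only [intervalIntegral.integral_const_mul, intervalIntegral.integral_mul_const]
  have h1 := hk.rep.2 x hx
  have h2 := hl.rep.2 t ht
  rw [h1, h2]; ring

/-- The reproducing kernel `G_{(y,s)}(x,t) = Q_y(x) q_s(t)` of `Ŵ(Ω)`. -/
def kernel (T : ℝ) [Fact (0 < T)] (y s : ℝ) : WHat T :=
  WHat.mk' (fun x t => kerOne y x * kerOne s t)
    (memAC2_mul (kerOne_memW21 1 y) (kerOne_memW21 T s))

/-- `Ψ_i = L* G_{(x_i,t_i)}`. -/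
def Psi (T : ℝ) [Fact (0 < T)] (p : ℕ → ℝ × ℝ) (i : ℕ) : W T :=
  ContinuousLinearMap.adjoint L (kernel T (p i).1 (p i).2)

/-- The Gram-Schmidt orthonormalisation of `(Ψ_i)`. Where `Ψ_i` depends linearly on its
predecessors (for instance for a repeated point, or for a corner with `t_i = 0`, where `Ψ_i = 0`),
`PsiHat T p i = 0`. -/
def PsiHat (T : ℝ) [Fact (0 < T)] (p : ℕ → ℝ × ℝ) : ℕ → W T :=
  InnerProductSpace.gramSchmidtNormed ℝ (Psi T p)

end

/-- `u ∈ W(Ω)` solves `L u = M(x,t,u(x,t))` on `Ω`; the homogeneous initial and boundary conditions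
`u(x,0) = ∂u/∂t(x,0) = u(0,t) = u(1,t) = 0` are part of `u ∈ W(Ω)`. -/
def IsSolution {T : ℝ} [Fact (0 < T)] (M : ℝ → ℝ → ℝ → ℝ) (u : W T) : Prop :=
  ∀ x ∈ Icc (0 : ℝ) 1, ∀ t ∈ Icc 0 T, L u x t = M x t (u x t)

/-- `β` is a matrix of orthogonalisation coefficients: `Ψ̂_i = ∑_{k ≤ i} β_ik Ψ_k`. -/
def IsCoeff (T : ℝ) [Fact (0 < T)] (p : ℕ → ℝ × ℝ) (β : ℕ → ℕ → ℝ) : Prop :=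
  ∀ i, PsiHat T p i = ∑ k ∈ Finset.range (i + 1), β i k • Psi T p k

/-- `A_i = ∑_{k ≤ i} β_ik M(x_k, t_k, u(x_k, t_k))`. -/
def coeff {T : ℝ} [Fact (0 < T)] (M : ℝ → ℝ → ℝ → ℝ) (p : ℕ → ℝ × ℝ) (β : ℕ → ℕ → ℝ) (u : W T)
    (i : ℕ) : ℝ :=
  ∑ k ∈ Finset.range (i + 1), β i k * M (p k).1 (p k).2 (u (p k).1 (p k).2)

end SGK

end

/-! By the reproducing property of `G`, `⟨Ψᵢ, u⟩ = (L u)(xᵢ, tᵢ)`. A function orthogonal to all `Ψᵢ`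
therefore solves the homogeneous wave equation on a dense set, hence on `Ω` by continuity, and the
energy `∫ ((∂ₜu)² + (∂ₓu)²) / 2 dx`, which starts from zero, shows that it vanishes. So the `Ψᵢ` are
total, the nonzero `Ψ̂ᵢ` form a Hilbert basis of `W(Ω)`, and the series in the theorem is the
expansion of `u` in this basis. -/

namespace SGK

section GramSchmidt

open Submodule InnerProductSpace

variable {𝕜 E ι : Type*} [RCLike 𝕜] [NormedAddCommGroup E] [InnerProductSpace 𝕜 E]
  [LinearOrder ι] [LocallyFiniteOrderBot ι] [WellFoundedLT ι]

theorem span_range_gramSchmidtNormed_ne_zero (f : ι → E) :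
    span 𝕜 (range fun i : {i | gramSchmidtNormed 𝕜 f i ≠ 0} => gramSchmidtNormed 𝕜 f i) =
      span 𝕜 (range f) := by
  have hrange : (range fun i : {i | gramSchmidtNormed 𝕜 f i ≠ 0} => gramSchmidtNormed 𝕜 f i) =
      range (gramSchmidtNormed 𝕜 f) \ {0} := by
    ext v
    simp only [mem_range, Subtype.exists, mem_ofPred_eq, Set.mem_sdiff, mem_singleton_iff]
    grind
  rw [hrange, span_sdiff_singleton_zero, span_gramSchmidtNormed_range, span_gramSchmidt]

theorem hasSum_gramSchmidtNormed [CompleteSpace E] {f : ι → E}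
    (hf : (span 𝕜 (range f))ᗮ = ⊥) (v : E) :
    HasSum (fun i => inner 𝕜 (gramSchmidtNormed 𝕜 f i) v • gramSchmidtNormed 𝕜 f i) v := by
  have hbot := (span_range_gramSchmidtNormed_ne_zero (𝕜 := 𝕜) f).symm ▸ hf
  have hsum := (HilbertBasis.mkOfOrthogonalEqBot
    (gramSchmidtNormed_orthonormal' f) hbot).hasSum_repr v
  simp only [HilbertBasis.repr_apply_apply, HilbertBasis.coe_mkOfOrthogonalEqBot] at hsum
  refine (hasSum_subtype_iff_of_support_subset (s := {i | gramSchmidtNormed 𝕜 f i ≠ 0})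
    fun i hi hzero => hi ?_).1 hsum
  simp only [hzero, smul_zero]

theorem exists_gramSchmidtNormed_eq_sum (f : ι → E) :
    ∃ β : ι → ι → 𝕜, ∀ i, gramSchmidtNormed 𝕜 f i = ∑ k ∈ Finset.Iic i, β i k • f k := by
  have h : ∀ i, ∃ c : ι → 𝕜, ∑ k ∈ Finset.Iic i, c k • f k = gramSchmidtNormed 𝕜 f i := fun i => by
    refine (mem_span_image_finset_iff_exists_fun' 𝕜).1 ?_
    rw [Finset.coe_Iic]
    exact smul_mem _ _ (gramSchmidt_mem_span 𝕜 f le_rfl)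
  choose β hβ using h
  exact ⟨β, fun i => (hβ i).symm⟩

end GramSchmidt

section ReproducingKernel

theorem integral_mul_indicator_Iic {S y : ℝ} (hy : y ∈ Icc 0 S) (h : ℝ → ℝ) :
    ∫ t in (0 : ℝ)..S, h t * (Iic y).indicator 1 t = ∫ t in (0 : ℝ)..y, h t := by
  simp only [← indicator_mul_right (Iic y), Pi.one_apply, mul_one]
  rw [intervalIntegral.integral_of_le (hy.1.trans hy.2), intervalIntegral.integral_of_le hy.1,
    setIntegral_indicator measurableSet_Iic, Ioc_inter_Iic, min_eq_right hy.2]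

theorem kerOne_zero {y : ℝ} (hy : 0 ≤ y) : kerOne y 0 = 1 := by
  rw [kerOne, if_pos hy, add_zero]

theorem kerOne_eq_one_add_min (y x : ℝ) : kerOne y x = 1 + min x y := by
  rw [kerOne, min_def, apply_ite (1 + ·)]

theorem kerOne_rep {S y : ℝ} (hy : 0 ≤ y) : Rep S (kerOne y) ((Iic y).indicator 1) := by
  refine ⟨(memLp_const (1 : ℝ)).indicator measurableSet_Iic, fun t ht => ?_⟩
  have hint : ∫ s in (0 : ℝ)..t, (Iic y).indicator (1 : ℝ → ℝ) s = min t y := by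
    rw [intervalIntegral.integral_of_le ht.1, setIntegral_indicator measurableSet_Iic,
      Ioc_inter_Iic, ← intervalIntegral.integral_of_le (le_min ht.1 hy)]
    simp
  rw [hint, kerOne_zero hy, kerOne_eq_one_add_min]

theorem Rep.mul {T : ℝ} {k l a b : ℝ → ℝ} (hk : Rep 1 k a) (hl : Rep T l b) :
    Rep2 T (fun x t => k x * l t) (fun x => l 0 * a x) (fun t => k 0 * b t)
      (fun z => a z.1 * b z.2) := by
  have hm : MemLp (fun z : ℝ × ℝ => a z.1 * b z.2) 2 (volume.restrict (Omega T)) := by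
    rw [restrict_Omega]
    refine (memLp_two_iff_integrable_sq
      ((hk.1.comp_fst (res T)).1.mul (hl.1.comp_snd (res 1)).1)).2 ?_
    simp only [Pi.mul_apply, mul_pow]
    exact hk.1.integrable_sq.mul_prod hl.1.integrable_sq
  refine ⟨(hk.smul (l 0)).congr fun x _ => mul_comm _ _, hl.smul (k 0), hm, fun x hx t ht => ?_⟩
  simp only [intervalIntegral.integral_const_mul, intervalIntegral.integral_mul_const]
  rw [hk.2 x hx, hl.2 t ht]
  ring

variable {T : ℝ} [Fact (0 < T)]

theorem kernel_rep {y s : ℝ} (hy : 0 ≤ y) (hs : 0 ≤ s) :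
    Rep2 T (kernel T y s) ((Iic y).indicator 1) ((Iic s).indicator 1)
      (fun z => (Iic y).indicator 1 z.1 * (Iic s).indicator 1 z.2) := by
  have h := ((kerOne_rep hy).mul (kerOne_rep hs)).congr (g := kernel T y s) pos.le
    fun x hx t ht => WHat.mk'_apply hx ht
  simpa only [kerOne_zero hy, kerOne_zero hs, one_mul] using h

theorem jet0_eq_of_rep {g : WHat T} {a b : ℝ → ℝ} {c : ℝ × ℝ → ℝ} (h : Rep2 T g a b c) :
    jet0 g = WithLp.toLp 2 (h.ra.1.toLp a, WithLp.toLp 2 (h.rb.1.toLp b, h.rc.1.toLp c)) := by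
  rw [← WHat.toLp_a h, ← WHat.toLp_b h, ← WHat.toLp_c h]
  rfl

theorem WHat.inner_eq_of_rep {f g : WHat T} {a b a' b' : ℝ → ℝ} {c c' : ℝ × ℝ → ℝ}
    (hf : Rep2 T f a b c) (hg : Rep2 T g a' b' c') :
    inner ℝ f g = f 0 0 * g 0 0 + ((∫ x in (0 : ℝ)..1, a x * a' x)
      + ((∫ t in (0 : ℝ)..T, b t * b' t)
      + ∫ x in (0 : ℝ)..1, ∫ t in (0 : ℝ)..T, c (x, t) * c' (x, t))) := by
  rw [WHat.inner_eq, innerHat_eq, jetHat_apply, jetHat_apply, jet0_eq_of_rep hf,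
    jet0_eq_of_rep hg]
  simp only [WithLp.prod_inner_apply, inner_toLp_int zero_le_one, inner_toLp_int pos.le,
    inner_toLp_dbl]
  rw [RCLike.inner_apply, conj_trivial, mul_comm (g 0 0)]

theorem inner_kernel (f : WHat T) {y s : ℝ} (hy : y ∈ Icc (0 : ℝ) 1) (hs : s ∈ Icc 0 T) :
    inner ℝ f (kernel T y s) = f y s := by
  have hzero : kernel T y s 0 0 = 1 := by
    rw [kernel, WHat.mk'_apply zmem1 zmemT, kerOne_zero hy.1, kerOne_zero hs.1, one_mul]
  have hmixed : ∫ x in (0 : ℝ)..1, ∫ t in (0 : ℝ)..T,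
      dxt T f (x, t) * ((Iic y).indicator 1 x * (Iic s).indicator 1 t) =
        ∫ x in (0 : ℝ)..y, ∫ t in (0 : ℝ)..s, dxt T f (x, t) := by
    simp only [← mul_assoc, integral_mul_indicator_Iic hs, intervalIntegral.integral_mul_const,
      integral_mul_indicator_Iic hy]
  rw [WHat.inner_eq_of_rep f.rep (kernel_rep hy.1 hs.1), hzero, hmixed,
    integral_mul_indicator_Iic hy, integral_mul_indicator_Iic hs]
  have hx := f.rep.ra.2 y hy
  have ht := f.rep.rb.2 s hs
  have hxt := f.rep.rc.2 y hy s hs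
  beta_reduce at hx
  linarith

theorem inner_Psi {p : ℕ → ℝ × ℝ} {i : ℕ} (hp : p i ∈ Omega T) (u : W T) :
    inner ℝ (Psi T p i) u = L u (p i).1 (p i).2 := by
  rw [Psi, ContinuousLinearMap.adjoint_inner_left, real_inner_comm, inner_kernel _ hp.1 hp.2]

end ReproducingKernel

section JetRegularity

variable {T : ℝ} [Fact (0 < T)]

theorem W.pd_eq_integral_pd_succ (u : W T) {i j : ℕ} (hi : i ≤ 2) (hj : j ≤ 1)
    (h : MemAC2 T (pd T u i (j + 1))) {x t : ℝ} (hx : x ∈ Icc (0 : ℝ) 1) (ht : t ∈ Icc 0 T) :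
    pd T u i j x t = ∫ s in (0 : ℝ)..t, pd T u i (j + 1) x s := by
  have hftc := ftc (u.jet.hasDeriv_t i hi j (by lia) x hx) (h.rep.slice_x pos.le hx) ht
  rwa [u.pd_bot hj hi x hx, zero_add] at hftc

theorem W.memAC2_pd_of_succ (u : W T) {i j : ℕ} (hi : i ≤ 2) (hj : j ≤ 1)
    (h : MemAC2 T (pd T u i (j + 1))) : MemAC2 T (pd T u i j) :=
  (memAC2_Vt pos.le h).congr pos.le fun _ hx _ ht => u.pd_eq_integral_pd_succ hi hj h hx ht

theorem W.memAC2_pd_zero_two (u : W T) : MemAC2 T (pd T u 0 2) :=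
  ((memAC2_xp pos.le (p_rep u)).add pos.le
    (memAC2_Vx pos.le (memAC2_Vx pos.le u.memAC2))).congr pos.le fun _ hx _ ht => u.s02 hx ht

theorem W.memAC2_pd_one_two (u : W T) : MemAC2 T (pd T u 1 2) := by
  have hone : Rep 1 (fun _ => (1 : ℝ)) 0 := ⟨MemLp.zero, by simp⟩
  refine (((hone.mul (p_rep u)).memAC2 pos.le).add pos.le
    (memAC2_Vx pos.le u.memAC2)).congr pos.le fun x hx t ht => ?_
  rw [u.s12 hx ht, one_mul]

theorem W.memAC2_pd (u : W T) {i j : ℕ} (hi : i ≤ 2) (hj : j ≤ 2) : MemAC2 T (pd T u i j) := by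
  have htwo : MemAC2 T (pd T u i 2) := by
    interval_cases i
    exacts [u.memAC2_pd_zero_two, u.memAC2_pd_one_two, u.memAC2]
  have hone := u.memAC2_pd_of_succ hi le_rfl htwo
  interval_cases j
  exacts [u.memAC2_pd_of_succ hi zero_le_one hone, hone, htwo]

theorem W.continuousOn_pd (u : W T) {i j : ℕ} (hi : i ≤ 2) (hj : j ≤ 2) :
    ContinuousOn (fun z : ℝ × ℝ => pd T u i j z.1 z.2) (Omega T) :=
  (u.memAC2_pd hi hj).rep.continuousOn pos.le

end JetRegularity

section Energy

variable {T : ℝ} [Fact (0 < T)]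

/-- The density `((∂ₜu)² + (∂ₓu)²) / 2` of the energy of the wave equation. -/
noncomputable def W.energyDensity (u : W T) (x t : ℝ) : ℝ :=
  (pd T u 0 1 x t ^ 2 + pd T u 1 0 x t ^ 2) / 2

/-- The time derivative of the energy density, written out. -/
noncomputable def W.energyRate (u : W T) (x t : ℝ) : ℝ :=
  pd T u 0 1 x t * pd T u 0 2 x t + pd T u 1 0 x t * pd T u 1 1 x t

theorem L_apply (u : W T) (x t : ℝ) : L u x t = pd T u 0 2 x t - pd T u 2 0 x t := rfl

theorem W.continuousOn_energyDensity (u : W T) :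
    ContinuousOn (fun z : ℝ × ℝ => u.energyDensity z.1 z.2) (Omega T) :=
  (((u.continuousOn_pd (by simp) (by simp)).pow 2).add
    ((u.continuousOn_pd (by simp) (by simp)).pow 2)).div_const 2

theorem W.continuousOn_energyRate (u : W T) :
    ContinuousOn (fun z : ℝ × ℝ => u.energyRate z.1 z.2) (Omega T) :=
  ((u.continuousOn_pd (by simp) (by simp)).mul (u.continuousOn_pd (by simp) (by simp))).add
    ((u.continuousOn_pd (by simp) (by simp)).mul (u.continuousOn_pd (by simp) (by simp)))

theorem W.integral_energyRate_time (u : W T) {x t : ℝ} (hx : x ∈ Icc (0 : ℝ) 1)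
    (ht : t ∈ Icc 0 T) : ∫ s in (0 : ℝ)..t, u.energyRate x s = u.energyDensity x t := by
  have hderiv : ∀ s ∈ Icc 0 T,
      HasDerivWithinAt (u.energyDensity x) (u.energyRate x s) (Icc 0 T) s := fun s hs => by
    refine ((((u.jet.hasDeriv_t 0 (by simp) 1 (by simp) x hx s hs).pow 2).add
      ((u.jet.hasDeriv_t 1 (by simp) 0 (by simp) x hx s hs).pow 2)).div_const 2).congr_deriv ?_
    rw [W.energyRate]
    ring
  have hinit : u.energyDensity x 0 = 0 := by
    simp [W.energyDensity, u.pd_bot le_rfl zero_le_two x hx, u.pd_bot zero_le_one one_le_two x hx]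
  have hftc := ftc hderiv (u.continuousOn_energyRate.uncurry_left x hx) ht
  rw [hftc, hinit, zero_add]

theorem W.integral_energyRate_space (u : W T) {t : ℝ} (ht : t ∈ Icc 0 T) :
    ∫ x in (0 : ℝ)..1, u.energyRate x t = ∫ x in (0 : ℝ)..1, pd T u 0 1 x t * L u x t := by
  have hrate : ContinuousOn (fun x => u.energyRate x t) (Icc 0 1) :=
    u.continuousOn_energyRate.uncurry_right t ht
  have hpower : ContinuousOn (fun x => pd T u 0 1 x t * L u x t) (Icc 0 1) :=
    ((u.continuousOn_pd (by simp) (by simp)).uncurry_right t ht).mul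
      (((L u).rep.continuousOn pos.le).uncurry_right t ht)
  -- The two integrands differ by the divergence `∂ₓ(∂ₜu ∂ₓu)`.
  have hdiv : ∀ x ∈ Icc (0 : ℝ) 1, HasDerivWithinAt (fun x => pd T u 0 1 x t * pd T u 1 0 x t)
      (u.energyRate x t - pd T u 0 1 x t * L u x t) (Icc 0 1) x := fun x hx => by
    refine ((u.jet.hasDeriv_x 0 (by simp) 1 (by simp) x hx t ht).mul
      (u.jet.hasDeriv_x 1 (by simp) 0 (by simp) x hx t ht)).congr_deriv ?_
    simp only [W.energyRate, L_apply, zero_add, Nat.reduceAdd]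
    ring
  have hleft := u.pd_side zmem1 (fun _ => u.bc_0t) (j := 1) (by simp) t ht
  have hright := u.pd_side omem1 (fun _ => u.bc_1t) (j := 1) (by simp) t ht
  have hftc := ftc hdiv (hrate.sub hpower) omem1
  beta_reduce at hftc
  rwa [hleft, hright, zero_mul, zero_mul, zero_add, eq_comm, intervalIntegral.integral_sub
    (hrate.intervalIntegrable_of_Icc zero_le_one) (hpower.intervalIntegrable_of_Icc zero_le_one),
    sub_eq_zero] at hftc

theorem W.integral_energyDensity (u : W T) {t : ℝ} (ht : t ∈ Icc 0 T) :
    ∫ x in (0 : ℝ)..1, u.energyDensity x t =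
      ∫ s in (0 : ℝ)..t, ∫ x in (0 : ℝ)..1, pd T u 0 1 x s * L u x s :=
  calc
    _ = ∫ x in (0 : ℝ)..1, ∫ s in (0 : ℝ)..t, u.energyRate x s :=
      intervalIntegral.integral_congr fun _ hx =>
        (u.integral_energyRate_time (uIcc_of_le (zero_le_one' ℝ) ▸ hx) ht).symm
    _ = ∫ s in (0 : ℝ)..t, ∫ x in (0 : ℝ)..1, u.energyRate x s :=
      swap_int (u.continuousOn_energyRate.integrableOn_compact (isCompact_Icc.prod isCompact_Icc))
        omem1 ht
    _ = _ := intervalIntegral.integral_congr fun _ hs =>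
      u.integral_energyRate_space (Icc_subset_Icc_right ht.2 (uIcc_of_le ht.1 ▸ hs))

theorem W.energyDensity_nonneg (u : W T) (x t : ℝ) : 0 ≤ u.energyDensity x t := by
  rw [W.energyDensity]
  positivity

theorem W.energyDensity_eq_zero_of_L_eq_zero {u : W T}
    (h : ∀ x ∈ Icc (0 : ℝ) 1, ∀ t ∈ Icc 0 T, L u x t = 0) {x t : ℝ} (hx : x ∈ Icc (0 : ℝ) 1)
    (ht : t ∈ Icc 0 T) : u.energyDensity x t = 0 := by
  have hpower : ∀ s ∈ uIcc 0 t, ∫ x in (0 : ℝ)..1, pd T u 0 1 x s * L u x s = 0 := fun s hs => by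
    rw [uIcc_of_le ht.1] at hs
    refine (intervalIntegral.integral_congr (g := fun _ => 0) fun y hy => ?_).trans
      intervalIntegral.integral_zero
    rw [uIcc_of_le zero_le_one] at hy
    exact mul_eq_zero_of_right _ (h y hy s (Icc_subset_Icc_right ht.2 hs))
  have henergy : ∫ x in (0 : ℝ)..1, u.energyDensity x t = 0 := by
    rw [u.integral_energyDensity ht, intervalIntegral.integral_congr (g := fun _ => 0) hpower,
      intervalIntegral.integral_zero]
  refine (u.energyDensity_nonneg x t).eq_of_not_lt' fun hpos => henergy.not_gt ?_
  exact intervalIntegral.integral_pos zero_lt_one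
    (u.continuousOn_energyDensity.uncurry_right t ht)
    (fun y _ => u.energyDensity_nonneg y t) ⟨x, hx, hpos⟩

theorem W.eq_zero_of_L_eq_zero {u : W T}
    (h : ∀ x ∈ Icc (0 : ℝ) 1, ∀ t ∈ Icc 0 T, L u x t = 0) : u = 0 := by
  have hvelocity : ∀ x ∈ Icc (0 : ℝ) 1, ∀ t ∈ Icc 0 T, pd T u 0 1 x t = 0 := fun x hx t ht => by
    have hdensity := W.energyDensity_eq_zero_of_L_eq_zero h hx ht
    rw [W.energyDensity] at hdensity
    nlinarith [sq_nonneg (pd T u 0 1 x t), sq_nonneg (pd T u 1 0 x t)]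
  refine W.ext fun x hx t ht => ?_
  have hu := u.pd_eq_integral_pd_succ zero_le_two zero_le_one
    (u.memAC2_pd (by simp) (by simp)) hx ht
  refine hu.trans ((intervalIntegral.integral_congr (g := fun _ => 0) fun s hs => ?_).trans
    intervalIntegral.integral_zero)
  rw [uIcc_of_le ht.1] at hs
  exact hvelocity x hx s (Icc_subset_Icc_right ht.2 hs)

end Energy

section Evaluation

variable {T : ℝ} [Fact (0 < T)]

theorem W.abs_pd_le_of_abs_pd_succ_le (u : W T) {i j : ℕ} (hi : i ≤ 2) (hj : j ≤ 1) {A x : ℝ}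
    (hx : x ∈ Icc (0 : ℝ) 1) (h : ∀ t ∈ Icc 0 T, |pd T u i (j + 1) x t| ≤ A) :
    ∀ t ∈ Icc 0 T, |pd T u i j x t| ≤ A * T := fun t ht => by
  have hA : 0 ≤ A := (abs_nonneg _).trans (h t ht)
  rw [u.pd_eq_integral_pd_succ hi hj (u.memAC2_pd hi (by lia)) hx ht]
  exact (int_bound ht.1 fun s hs => h s (Icc_subset_Icc_right ht.2 hs)).trans
    (mul_le_mul_of_nonneg_left ht.2 hA)

theorem W.exists_abs_apply_le :
    ∃ C : ℝ, ∀ u : W T, ∀ x ∈ Icc (0 : ℝ) 1, ∀ t ∈ Icc 0 T, |u x t| ≤ C * ‖u‖ := by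
  obtain ⟨C, hC⟩ := D_bound (T := T)
  obtain ⟨B, hB⟩ := pd_bound (T := T)
  refine ⟨|B| * C * T * T, fun u x hx t ht => ?_⟩
  have hacc : ∀ s ∈ Icc 0 T, |pd T u 0 2 x s| ≤ |B| * C * ‖u‖ := fun s hs =>
    calc |pd T u 0 2 x s| ≤ B * ‖W.D u‖ := (hB u x hx s hs).2.1
      _ ≤ |B| * (C * ‖u‖) := by gcongr; exacts [le_abs_self B, hC u]
      _ = |B| * C * ‖u‖ := (mul_assoc _ _ _).symm
  have hvel := u.abs_pd_le_of_abs_pd_succ_le zero_le_two le_rfl hx hacc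
  refine (u.abs_pd_le_of_abs_pd_succ_le zero_le_two zero_le_one hx hvel t ht).trans_eq ?_
  ring

/-- Point evaluation on `W(Ω)`. Its continuity turns convergence in norm into pointwise
convergence. -/
noncomputable def W.evalCLM (x t : ℝ) (hx : x ∈ Icc (0 : ℝ) 1) (ht : t ∈ Icc 0 T) : W T →L[ℝ] ℝ :=
  LinearMap.mkContinuousOfExistsBound
    { toFun := fun u => u x t
      map_add' := fun _ _ => rfl
      map_smul' := fun _ _ => rfl }
    (W.exists_abs_apply_le.imp fun _ hC u => hC u x hx t ht)

end Evaluation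

section Expansion

variable {T : ℝ} [Fact (0 < T)] {p : ℕ → ℝ × ℝ}

theorem orthogonal_span_range_Psi (hp : ∀ i, p i ∈ Omega T)
    (hdense : Omega T ⊆ closure (range p)) : (Submodule.span ℝ (range (Psi T p)))ᗮ = ⊥ := by
  refine (Submodule.eq_bot_iff _).2 fun u hu => ?_
  have hpoint : EqOn (fun z : ℝ × ℝ => L u z.1 z.2) 0 (range p) := by
    rintro _ ⟨i, rfl⟩
    exact (inner_Psi (hp i) u).symm.trans
      (Submodule.inner_right_of_mem_orthogonal (Submodule.subset_span (mem_range_self i)) hu)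
  have hLu := hpoint.of_subset_closure ((L u).rep.continuousOn pos.le) continuousOn_const
    (range_subset_iff.2 hp) hdense
  exact W.eq_zero_of_L_eq_zero fun x hx t ht => hLu (mk_mem_prod hx ht)

theorem exists_isCoeff : ∃ β, IsCoeff T p β := by
  obtain ⟨β, hβ⟩ := exists_gramSchmidtNormed_eq_sum (𝕜 := ℝ) (Psi T p)
  exact ⟨β, fun i => Nat.range_succ_eq_Iic i ▸ hβ i⟩

theorem inner_PsiHat (hp : ∀ i, p i ∈ Omega T) {β : ℕ → ℕ → ℝ} (hβ : IsCoeff T p β) (u : W T)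
    (i : ℕ) :
    inner ℝ (PsiHat T p i) u =
      ∑ k ∈ Finset.range (i + 1), β i k * L u (p k).1 (p k).2 := by
  simp only [hβ i, sum_inner, real_inner_smul_left, inner_Psi (hp _)]

theorem IsSolution.inner_PsiHat {M : ℝ → ℝ → ℝ → ℝ} {u : W T} (hu : IsSolution M u)
    (hp : ∀ i, p i ∈ Omega T) {β : ℕ → ℕ → ℝ} (hβ : IsCoeff T p β) (i : ℕ) :
    inner ℝ (PsiHat T p i) u = coeff M p β u i := by
  rw [SGK.inner_PsiHat hp hβ, coeff]
  exact Finset.sum_congr rfl fun k _ => by rw [hu _ (hp k).1 _ (hp k).2]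

theorem IsSolution.hasSum_coeff_smul_PsiHat {M : ℝ → ℝ → ℝ → ℝ} {u : W T} (hu : IsSolution M u)
    (hp : ∀ i, p i ∈ Omega T) (hdense : Omega T ⊆ closure (range p)) {β : ℕ → ℕ → ℝ}
    (hβ : IsCoeff T p β) : HasSum (fun i => coeff M p β u i • PsiHat T p i) u := by
  simp only [← hu.inner_PsiHat hp hβ]
  exact hasSum_gramSchmidtNormed (orthogonal_span_range_Psi hp hdense) u

end Expansion

end SGK

theorem theorem3p2 (T : ℝ) [Fact (0 < T)] (M : ℝ → ℝ → ℝ → ℝ) (p : ℕ → ℝ × ℝ)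
    (hp : ∀ i, p i ∈ SGK.Omega T) (hdense : SGK.Omega T ⊆ closure (Set.range p)) :
    (∃ β : ℕ → ℕ → ℝ, SGK.IsCoeff T p β) ∧
    ∀ β : ℕ → ℕ → ℝ, SGK.IsCoeff T p β → ∀ u : SGK.W T, SGK.IsSolution M u →
      HasSum (fun i => SGK.coeff M p β u i • SGK.PsiHat T p i) u ∧
      (∀ x ∈ Set.Icc (0 : ℝ) 1, ∀ t ∈ Set.Icc 0 T,
        HasSum (fun i => SGK.coeff M p β u i * SGK.PsiHat T p i x t) (u x t)) ∧
      Filter.Tendsto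
        (fun n => ‖(∑ i ∈ Finset.range n, SGK.coeff M p β u i • SGK.PsiHat T p i) - u‖)
        Filter.atTop (nhds 0) := by
  refine ⟨SGK.exists_isCoeff, fun β hβ u hu => ?_⟩
  have hsum := hu.hasSum_coeff_smul_PsiHat hp hdense hβ
  exact ⟨hsum, fun x hx t ht => (SGK.W.evalCLM x t hx ht).hasSum hsum,
    tendsto_iff_norm_sub_tendsto_zero.1 hsum.tendsto_sum_nat⟩
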